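/- **Theorem (generalization of Krein's formula).** Let $0<\nu<1$ and let $V:[0,\infty)\to\mathbb{R}$ be analytic on $[0,\infty)$ (including at the endpoint $0$) and bounded from below. Let $$A=-\partial_x^2+\frac{\nu^2-1/4}{x^2}+V(x)$$ be the operator in $L^2(0,\infty)$ with domain $C_0^\infty(0,\infty)$, and let $A^\dagger$ be its adjoint. For real $\theta$ let $A^\theta$ be the restriction of $A^\dagger$ to those $\varphi\in\mathcal D(A^\dagger)$ such that, for some $C\in\mathbb{C}$, $\varphi(x)=C\,(x^{1/2-\nu}+\theta\,x^{1/2+\nu})+O(x^{3/2})$ as $x\to0^+$, and let $A^\infty$ (the Friedrichs extension) be the restriction of $A^\dagger$ to those $\varphi$ such that $\varphi(x)=C\,x^{1/2+\nu}+O(x^{3/2})$ for some $C\in\mathbb{C}$. There is a function $K$ on the common resolvent set of $A^0$ and $A^\infty$ such that for every $\lambda$ in this set the following hold. 1. $K(\lambda)\neq0$, and $K(\lambda)=\phi^0(\lambda)/\phi^\infty(\lambda)$, where for $f\in L^2(0,\infty)$ the numbers $\phi^0(\lambda)$, $\phi^\infty(\lambda)$ are the coefficients in $$(A^0-\lambda)^{-1}f(x)=\phi^0(\lambda)\,x^{1/2-\nu}+O(x^{3/2}),\qquad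 (A^\infty-\lambda)^{-1}f(x)=\phi^\infty(\lambda)\,x^{1/2+\nu}+O(x^{3/2})\qquad(x\to0^+).$$ That is, $\phi^0(\lambda)=K(\lambda)\,\phi^\infty(\lambda)$ for every $f$, and $\phi^\infty(\lambda)\ne0$ for some $f$. 2. $(A^\infty-\lambda)^{-1}$ has an integral kernel $G_\infty(x,x',\lambda)$, continuous on $(0,\infty)^2$ and square integrable in $x'$ for each $x>0$; the limit $G_\infty(x',\lambda):=\lim_{x\to0^+}x^{-\nu-1/2}G_\infty(x,x',\lambda)$ exists for every $x'>0$; and, as $x\to0^+$, $$G_\infty(x,\lambda)=\frac1{2\nu}\left(x^{1/2-\nu}-K(\lambda)^{-1}x^{1/2+\nu}\right)+O(x^{3/2}).$$ 3. For every real $\theta$ such that $\lambda$ is also in the resolvent set of $A^\theta$, one has $1+\theta K(\lambda)\neq0$ and $$(A^\theta-\lambda)^{-1}-(A^\infty-\lambda)^{-1}=\frac{(A^0-\lambda)^{-1}-(A^\infty-\lambda)^{-1}}{1+\theta\,K(\lambda)}.$$ -/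

import Mathlib

open MeasureTheory Set Filter Topology Asymptotics
open scoped ContDiff

noncomputable section

namespace SingularKrein

/-- Lebesgue measure on the half-line `(0, ∞)`. -/
abbrev halfLine : Measure ℝ := volume.restrict (Ioi (0 : ℝ))

/-- The Hilbert space `L²((0, ∞); ℂ)`. -/
abbrev H : Type := Lp ℂ 2 halfLine

/-- Smooth complex functions with compact support contained in the open half-line `(0, ∞)`. -/
def IsTest (φ : ℝ → ℂ) : Prop :=
  ContDiff ℝ ∞ φ ∧ HasCompactSupport φ ∧ tsupport φ ⊆ Ioi (0 : ℝ)

/-- The differential expression `-u'' + ((ν² - 1/4) / x² + V(x)) u`. -/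
def expr (ν : ℝ) (V : ℝ → ℝ) (u : ℝ → ℂ) (x : ℝ) : ℂ :=
  -deriv (deriv u) x + (((ν ^ 2 - 1 / 4) / x ^ 2 + V x : ℝ) : ℂ) * u x

theorem IsTest.add {φ ψ : ℝ → ℂ} (hφ : IsTest φ) (hψ : IsTest ψ) :
    IsTest (fun x => φ x + ψ x) := by
  refine ⟨hφ.1.add hψ.1, hφ.2.1.add hψ.2.1, ?_⟩
  exact (tsupport_add φ ψ).trans (union_subset hφ.2.2 hψ.2.2)

theorem IsTest.const_mul {φ : ℝ → ℂ} (c : ℂ) (hφ : IsTest φ) :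
    IsTest (fun x => c * φ x) := by
  refine ⟨contDiff_const.mul hφ.1, hφ.2.1.mul_left, ?_⟩
  exact (tsupport_mul_subset_right (f := fun _ : ℝ => c) (g := φ)).trans hφ.2.2

theorem IsTest.zero : IsTest (fun _ => 0) := by
  refine ⟨contDiff_const, HasCompactSupport.zero, ?_⟩
  have h : tsupport (fun _ : ℝ => (0 : ℂ)) = ∅ := by
    rw [tsupport_eq_empty_iff]; rfl
  rw [h]
  exact empty_subset _

theorem IsTest.differentiable {φ : ℝ → ℂ} (hφ : IsTest φ) : Differentiable ℝ φ :=
  hφ.1.differentiable (by simp)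

theorem IsTest.differentiable_deriv {φ : ℝ → ℂ} (hφ : IsTest φ) :
    Differentiable ℝ (deriv φ) :=
  ((contDiff_infty_iff_deriv.1 hφ.1).2).differentiable (by simp)

theorem expr_add (ν : ℝ) (V : ℝ → ℝ) {φ ψ : ℝ → ℂ} (hφ : IsTest φ) (hψ : IsTest ψ) (x : ℝ) :
    expr ν V (fun y => φ y + ψ y) x = expr ν V φ x + expr ν V ψ x := by
  have h : deriv (fun y => φ y + ψ y) = fun y => deriv φ y + deriv ψ y := by
    funext y
    exact deriv_fun_add (hφ.differentiable y) (hψ.differentiable y)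
  unfold expr
  rw [h, deriv_fun_add (hφ.differentiable_deriv x) (hψ.differentiable_deriv x)]
  ring

theorem expr_const_mul (ν : ℝ) (V : ℝ → ℝ) (c : ℂ) {φ : ℝ → ℂ} (hφ : IsTest φ) (x : ℝ) :
    expr ν V (fun y => c * φ y) x = c * expr ν V φ x := by
  have h : deriv (fun y => c * φ y) = fun y => c * deriv φ y := by
    funext y
    exact deriv_const_mul c (hφ.differentiable y)
  unfold expr
  rw [h, deriv_const_mul c (hφ.differentiable_deriv x)]
  ring

/-- The graph of the operator `-∂² + (ν² - 1/4) / x² + V(x)` on the test functions. -/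
def minGraph (ν : ℝ) (V : ℝ → ℝ) : Submodule ℂ (H × H) where
  carrier := {p | ∃ φ : ℝ → ℂ, IsTest φ ∧ p.1 =ᵐ[halfLine] φ ∧ p.2 =ᵐ[halfLine] expr ν V φ}
  zero_mem' := by
    refine ⟨fun _ => 0, IsTest.zero, Lp.coeFn_zero ℂ 2 halfLine, ?_⟩
    have h : expr ν V (fun _ => 0) = 0 := by
      funext x; simp [expr]
    rw [h]
    exact Lp.coeFn_zero ℂ 2 halfLine
  add_mem' := by
    rintro p q ⟨φ, hφ, hp1, hp2⟩ ⟨ψ, hψ, hq1, hq2⟩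
    refine ⟨fun x => φ x + ψ x, hφ.add hψ, ?_, ?_⟩
    · filter_upwards [Lp.coeFn_add p.1 q.1, hp1, hq1] with x h1 h2 h3
      simp only [Prod.fst_add, h1, Pi.add_apply, h2, h3]
    · filter_upwards [Lp.coeFn_add p.2 q.2, hp2, hq2] with x h1 h2 h3
      rw [expr_add ν V hφ hψ]
      simp only [Prod.snd_add, h1, Pi.add_apply, h2, h3]
  smul_mem' := by
    rintro c p ⟨φ, hφ, hp1, hp2⟩
    refine ⟨fun x => c * φ x, hφ.const_mul c, ?_, ?_⟩
    · filter_upwards [Lp.coeFn_smul c p.1, hp1] with x h1 h2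
      simp only [Prod.smul_fst, h1, Pi.smul_apply, h2, smul_eq_mul]
    · filter_upwards [Lp.coeFn_smul c p.2, hp2] with x h1 h2
      rw [expr_const_mul ν V c hφ]
      simp only [Prod.smul_snd, h1, Pi.smul_apply, h2, smul_eq_mul]

/-- The graph is single-valued. -/
theorem minGraph_snd_eq_zero (ν : ℝ) (V : ℝ → ℝ) (p : H × H) (hp : p ∈ minGraph ν V)
    (h0 : p.1 = 0) : p.2 = 0 := by
  obtain ⟨φ, hφ, h1, h2⟩ := hp
  have hz : (0 : ℝ → ℂ) =ᵐ[halfLine] φ := by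
    rw [h0] at h1
    exact (Lp.coeFn_zero ℂ 2 halfLine).symm.trans h1
  have hE : EqOn (0 : ℝ → ℂ) φ (Ioi 0) :=
    Measure.eqOn_open_of_ae_eq hz isOpen_Ioi continuousOn_const hφ.1.continuous.continuousOn
  have hφ0 : φ = fun _ => 0 := by
    funext x
    by_cases hx : x ∈ Ioi (0 : ℝ)
    · exact (hE hx).symm
    · exact image_eq_zero_of_notMem_tsupport (fun h => hx (hφ.2.2 h))
  have h : expr ν V φ = 0 := by
    rw [hφ0]; funext x; simp [expr]
  rw [h] at h2
  exact (Lp.eq_zero_iff_ae_eq_zero).2 h2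

/-- The operator `A = -∂² + (ν² - 1/4) / x² + V(x)` in `L²(0, ∞)` with domain `C₀^∞(0, ∞)`. -/
def A (ν : ℝ) (V : ℝ → ℝ) : H →ₗ.[ℂ] H := (minGraph ν V).toLinearPMap

theorem A_graph (ν : ℝ) (V : ℝ → ℝ) : (A ν V).graph = minGraph ν V :=
  Submodule.toLinearPMap_graph_eq _ (minGraph_snd_eq_zero ν V)

/-- `x ^ (1/2 - ν)`, the dominant local behaviour at the singularity. -/
def bMinus (ν x : ℝ) : ℂ := ((x ^ (1 / 2 - ν) : ℝ) : ℂ)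

/-- `x ^ (1/2 + ν)`, the subdominant local behaviour at the singularity. -/
def bPlus (ν x : ℝ) : ℂ := ((x ^ (1 / 2 + ν) : ℝ) : ℂ)

/-- `f(x) = O(x^{3/2})` as `x → 0⁺`. -/
def IsRemainder (f : ℝ → ℂ) : Prop :=
  f =O[𝓝[>] (0 : ℝ)] fun x => x ^ (3 / 2 : ℝ)

/-- The class `φ ∈ L²(0, ∞)` has a representative `u` with `u(x) = C b(x) + O(x^{3/2})`
as `x → 0⁺`. -/
def HasBoundaryCoeff (b : ℝ → ℂ) (φ : H) (C : ℂ) : Prop :=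
  ∃ u : ℝ → ℂ, φ =ᵐ[halfLine] u ∧ IsRemainder fun x => u x - C * b x

/-- The `φ ∈ L²(0, ∞)` with `φ(x) = C b(x) + O(x^{3/2})` as `x → 0⁺`, for some constant `C`. -/
def boundarySpace (b : ℝ → ℂ) : Submodule ℂ H where
  carrier := {φ | ∃ C : ℂ, HasBoundaryCoeff b φ C}
  zero_mem' := by
    refine ⟨0, 0, Lp.coeFn_zero ℂ 2 halfLine, ?_⟩
    simpa [IsRemainder] using isBigO_zero (fun x : ℝ => x ^ (3 / 2 : ℝ)) (𝓝[>] (0 : ℝ))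
  add_mem' := by
    rintro φ ψ ⟨C, u, hu, hu'⟩ ⟨D, v, hv, hv'⟩
    refine ⟨C + D, u + v, (Lp.coeFn_add φ ψ).trans (hu.add hv), ?_⟩
    refine (IsBigO.add hu' hv').congr_left fun x => ?_
    simp only [Pi.add_apply]
    ring
  smul_mem' := by
    rintro c φ ⟨C, u, hu, hu'⟩
    refine ⟨c * C, c • u, (Lp.coeFn_smul c φ).trans (hu.const_smul c), ?_⟩
    refine (IsBigO.const_mul_left hu' c).congr_left fun x => ?_
    simp only [Pi.smul_apply, smul_eq_mul]
    ring

/-- The extension `A^θ`: the restriction of `A†` to the `φ` with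
`φ(x) = C (x^{1/2 - ν} + θ x^{1/2 + ν}) + O(x^{3/2})`. -/
def ATheta (ν : ℝ) (V : ℝ → ℝ) (θ : ℝ) : H →ₗ.[ℂ] H :=
  (A ν V).adjoint.domRestrict (boundarySpace fun x => bMinus ν x + (θ : ℂ) * bPlus ν x)

/-- The extension `A^∞`: the restriction of `A†` to the `φ` with
`φ(x) = C x^{1/2 + ν} + O(x^{3/2})`. -/
def AInf (ν : ℝ) (V : ℝ → ℝ) : H →ₗ.[ℂ] H :=
  (A ν V).adjoint.domRestrict (boundarySpace (bPlus ν))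

/-- `z` belongs to the resolvent set of `T`, and `R = (T - z)⁻¹`. -/
def IsResolvent (T : H →ₗ.[ℂ] H) (z : ℂ) (R : H →L[ℂ] H) : Prop :=
  (∀ f : H, ∃ h : R f ∈ T.domain, T ⟨R f, h⟩ - z • R f = f) ∧
    ∀ u : T.domain, R (T u - z • (u : H)) = u

/-- `G` is the (continuous) integral kernel of the operator `R` on `L²(0, ∞)`. -/
def IsKernel (R : H →L[ℂ] H) (G : ℝ → ℝ → ℂ) : Prop :=
  ContinuousOn (fun p : ℝ × ℝ => G p.1 p.2) (Ioi 0 ×ˢ Ioi 0) ∧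
    (∀ x > 0, MemLp (G x) 2 halfLine) ∧
    ∀ f : H, ∀ᵐ x ∂halfLine, R f x = ∫ y, G x y * f y ∂halfLine

/-- `K = φ⁰ / φ^∞`: for every `f`, `φ⁰` is the coefficient of `x^{1/2 - ν}` in
`(A⁰ - z)⁻¹ f` and `φ^∞` that of `x^{1/2 + ν}` in `(A^∞ - z)⁻¹ f`; the ratio does not depend
on `f`, and `φ^∞ ≠ 0` for some `f`. -/
def IsBoundaryRatio (ν : ℝ) (R₀ Rinf : H →L[ℂ] H) (K : ℂ) : Prop :=
  (∃ f c, HasBoundaryCoeff (bPlus ν) (Rinf f) c ∧ c ≠ 0) ∧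
    ∀ f c₀ c, HasBoundaryCoeff (bMinus ν) (R₀ f) c₀ → HasBoundaryCoeff (bPlus ν) (Rinf f) c →
      c₀ = K * c

/-- The boundary value `g(y) = lim_{x → 0⁺} x^{-ν-1/2} G(x, y)` of the kernel `G` of `Rinf`
exists, and `g(y) = (1 / 2ν) (y^{1/2 - ν} - K⁻¹ y^{1/2 + ν}) + O(y^{3/2})` as `y → 0⁺`. -/
def IsKernelRatio (ν : ℝ) (Rinf : H →L[ℂ] H) (K : ℂ) : Prop :=
  ∃ (G : ℝ → ℝ → ℂ) (g : ℝ → ℂ), IsKernel Rinf G ∧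
    (∀ y > 0, Tendsto (fun x : ℝ => ((x ^ (-ν - 1 / 2) : ℝ) : ℂ) * G x y) (𝓝[>] 0) (𝓝 (g y))) ∧
    IsRemainder fun y => g y - 1 / (2 * (ν : ℂ)) * (bMinus ν y - K⁻¹ * bPlus ν y)

end SingularKrein

end

/-!
Let `z` be a common resolvent point. The function `x^{1/2 - ν}`, cut off at infinity, lies in the
domain of `A†`; correcting it by `(A^∞ - z)⁻¹` gives a solution `u ∈ L²` of `A† u = z u` with
`u = x^{1/2 - ν} + m x^{1/2 + ν} + O(x^{3/2})` (`exists_mem_graph_adjoint_smul`). If such a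
solution had the boundary behaviour of `A^θ`, that is `m = θ`, then `z` would be an eigenvalue of
`A^θ`; so `m ≠ 0`, and `m ≠ θ` when `z` is in the resolvent set of `A^θ`. The difference of any two
of the resolvents maps `f` to a solution, which is a multiple of `u` because `A^∞ - z` is injective,
and the multiple is read off from the boundary coefficients (`resolvent_sub_eq_smul`). Linear
algebra with these coefficients gives `K = -1 / m` and Krein's formula.

The Green kernel of `(A^∞ - z)⁻¹` is `φ(min x y) u(max x y) / (2ν)`, where `φ ~ x^{1/2 + ν}` is the
regular solution, obtained from a Volterra equation (`exists_regular_solution`). For this `u` must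
be a classical solution, which is the regularity of weak solutions
(`exists_classical_of_mem_graph_adjoint`, from the lemma of du Bois-Reymond), and the Wronskian must
be `2ν` (`wronskian_eq_two_mul`). The kernel inverts `A^∞ - z` on test functions by a direct
computation, and everywhere by density. Multiplied by `x^{-1/2 - ν}` it tends to
`u(y) / (2ν)` as `x → 0`, whose expansion in `y` is the asserted one.
-/

noncomputable section

namespace SingularKrein

/-! ### Real test functions and the lemma of du Bois-Reymond -/

/-- Real-valued smooth functions with compact support in the open half-line. -/
def IsRealTest (g : ℝ → ℝ) : Prop :=
  ContDiff ℝ ∞ g ∧ HasCompactSupport g ∧ tsupport g ⊆ Ioi (0 : ℝ)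

theorem exists_Icc_of_isCompact {K : Set ℝ} (hK : IsCompact K) (h : K ⊆ Ioi 0) :
    ∃ a b : ℝ, 0 < a ∧ a < 1 ∧ 1 < b ∧ K ⊆ Icc a b := by
  obtain ⟨M, hM⟩ := hK.bddAbove
  have hpos : ∃ c > 0, ∀ x ∈ K, c ≤ x := by
    rcases K.eq_empty_or_nonempty with rfl | hne
    · exact ⟨1, one_pos, by simp⟩
    · obtain ⟨c, hc, hc'⟩ := hK.exists_isLeast hne
      exact ⟨c, h hc, fun x hx => hc' hx⟩
  obtain ⟨c, hc, hcK⟩ := hpos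
  refine ⟨min c (1 / 2), max M 2, by positivity, ?_, ?_, fun x hx => ⟨?_, ?_⟩⟩
  · exact lt_of_le_of_lt (min_le_right _ _) (by norm_num)
  · exact lt_of_lt_of_le (by norm_num) (le_max_right _ _)
  · exact (min_le_left _ _).trans (hcK x hx)
  · exact (hM hx).trans (le_max_left _ _)

theorem IsRealTest.exists_Icc {g : ℝ → ℝ} (hg : IsRealTest g) :
    ∃ a b : ℝ, 0 < a ∧ a < 1 ∧ 1 < b ∧ tsupport g ⊆ Ioo a b := by
  obtain ⟨a, b, ha, ha1, hb, hK⟩ := exists_Icc_of_isCompact hg.2.1 hg.2.2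
  refine ⟨a / 2, b + 1, by linarith, by linarith, by linarith, fun x hx => ?_⟩
  have := hK hx
  exact ⟨by linarith [this.1], by linarith [this.2]⟩

theorem IsRealTest.of_eq_zero {g : ℝ → ℝ} (hg : ContDiff ℝ ∞ g) {a b : ℝ} (ha : 0 < a)
    (h : ∀ x, x ∉ Icc a b → g x = 0) : IsRealTest g := by
  have hs : tsupport g ⊆ Icc a b :=
    closure_minimal (fun x hx => by_contra fun hn => hx (h x hn)) isClosed_Icc
  exact ⟨hg, HasCompactSupport.of_support_subset_isCompact isCompact_Icc
    (subset_closure.trans hs), fun x hx => ha.trans_le (hs hx).1⟩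

theorem IsRealTest.differentiable {g : ℝ → ℝ} (hg : IsRealTest g) : Differentiable ℝ g :=
  hg.1.differentiable (by simp)

theorem IsRealTest.continuous {g : ℝ → ℝ} (hg : IsRealTest g) : Continuous g :=
  hg.1.continuous

theorem IsRealTest.deriv {g : ℝ → ℝ} (hg : IsRealTest g) : IsRealTest (deriv g) :=
  ⟨(contDiff_infty_iff_deriv.1 hg.1).2, hg.2.1.deriv,
    (closure_mono support_deriv_subset).trans ((closure_closure).subset.trans hg.2.2)⟩

theorem IsRealTest.sub {f g : ℝ → ℝ} (hf : IsRealTest f) (hg : IsRealTest g) :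
    IsRealTest (fun x => f x - g x) :=
  ⟨hf.1.sub hg.1, hf.2.1.sub hg.2.1, (tsupport_sub f g).trans (union_subset hf.2.2 hg.2.2)⟩

theorem IsRealTest.const_mul {g : ℝ → ℝ} (c : ℝ) (hg : IsRealTest g) :
    IsRealTest (fun x => c * g x) :=
  ⟨contDiff_const.mul hg.1, hg.2.1.mul_left,
    (tsupport_mul_subset_right (f := fun _ : ℝ => c) (g := g)).trans hg.2.2⟩

/-- An integral over the half-line against a function supported in `[a, b]`. -/
theorem integral_halfLine_eq_intervalIntegral {a b : ℝ} (ha : 0 < a) (hab : a ≤ b) {F : ℝ → ℂ}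
    (h : ∀ x, x ∉ Ioo a b → F x = 0) : ∫ x, F x ∂halfLine = ∫ x in a..b, F x := by
  rw [intervalIntegral.integral_of_le hab]
  refine setIntegral_eq_of_subset_of_forall_sdiff_eq_zero measurableSet_Ioi
    (fun x hx => ha.trans hx.1) fun x hx => h x fun hx' => hx.2 ⟨hx'.1, hx'.2.le⟩

theorem intervalIntegrable_of_locallyIntegrableOn {f : ℝ → ℂ}
    (hf : LocallyIntegrableOn f (Ioi 0)) {a b : ℝ} (ha : 0 < a) (hb : 0 < b) :
    IntervalIntegrable f volume a b := by
  have hs : uIcc a b ⊆ Ioi 0 := fun x hx => lt_of_lt_of_le (lt_min ha hb) hx.1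
  exact (hf.integrableOn_compact_subset hs isCompact_uIcc).intervalIntegrable

theorem integrable_smul_of_isRealTest {f : ℝ → ℂ} (hf : LocallyIntegrableOn f (Ioi 0))
    {g : ℝ → ℝ} (hg : IsRealTest g) : Integrable (fun x => g x • f x) halfLine := by
  obtain ⟨a, b, ha, ha1, hb, hs⟩ := hg.exists_Icc
  have h : ∀ x, x ∉ Ioo a b → g x = 0 := fun x hx =>
    image_eq_zero_of_notMem_tsupport fun h' => hx (hs h')
  have hab : a ≤ b := by linarith
  have hi : IntegrableOn (fun x => g x • f x) (Ioc a b) := by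
    rw [← intervalIntegrable_iff_integrableOn_Ioc_of_le hab]
    exact (intervalIntegrable_of_locallyIntegrableOn hf ha (by linarith)).continuousOn_smul
      hg.continuous.continuousOn
  refine hi.of_forall_sdiff_eq_zero measurableSet_Ioi fun x hx => ?_
  rw [h x fun hx' => hx.2 ⟨hx'.1, hx'.2.le⟩, zero_smul]

/-- Test functions with integral zero are derivatives of test functions. -/
theorem IsRealTest.exists_deriv_eq {η : ℝ → ℝ} (hη : IsRealTest η)
    (h0 : ∫ x, η x ∂halfLine = 0) : ∃ χ, IsRealTest χ ∧ _root_.deriv χ = η := by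
  obtain ⟨a, b, ha, ha1, hb, hs⟩ := hη.exists_Icc
  have h : ∀ x, x ∉ Ioo a b → η x = 0 := fun x hx =>
    image_eq_zero_of_notMem_tsupport fun h' => hx (hs h')
  have hab : a ≤ b := by linarith
  have hint : ∫ x in a..b, η x = 0 := by
    rw [← h0, intervalIntegral.integral_of_le hab]
    exact (setIntegral_eq_of_subset_of_forall_sdiff_eq_zero measurableSet_Ioi
      (fun x hx => ha.trans (hx : x ∈ Ioc a b).1)
      fun x hx => h x fun hx' => hx.2 ⟨hx'.1, hx'.2.le⟩).symm
  have hd : ∀ x, HasDerivAt (fun x => ∫ t in a..x, η t) (η x) x := fun x =>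
    intervalIntegral.integral_hasDerivAt_right (hη.continuous.intervalIntegrable _ _)
      (hη.continuous.stronglyMeasurableAtFilter _ _) hη.continuous.continuousAt
  have hde : _root_.deriv (fun x => ∫ t in a..x, η t) = η := funext fun x => (hd x).deriv
  refine ⟨fun x => ∫ t in a..x, η t, IsRealTest.of_eq_zero (a := a) (b := b) ?_ ha ?_, hde⟩
  · rw [contDiff_infty_iff_deriv, hde]
    exact ⟨fun x => (hd x).differentiableAt, hη.1⟩
  · intro x hx
    rcases lt_or_ge x a with hxa | hxa
    · refine (intervalIntegral.integral_congr (g := fun _ => 0) fun t ht => h t ?_).trans (by simp)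
      rw [uIcc_of_ge hxa.le] at ht
      exact fun h' => absurd h'.1 (not_lt.2 ht.2)
    · have hxb : b < x := lt_of_not_ge fun hh => hx ⟨hxa, hh⟩
      rw [← intervalIntegral.integral_add_adjacent_intervals
        (hη.continuous.intervalIntegrable a b) (hη.continuous.intervalIntegrable b x),
        hint, zero_add]
      refine (intervalIntegral.integral_congr (g := fun _ => 0) fun t ht => h t ?_).trans (by simp)
      rw [uIcc_of_le hxb.le] at ht
      exact fun h' => absurd h'.2 (not_lt.2 ht.1)

theorem exists_isRealTest_integral_eq_one :
    ∃ ρ, IsRealTest ρ ∧ ∫ x, ρ x ∂halfLine = 1 := by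
  let f : ContDiffBump (2 : ℝ) := ⟨1 / 2, 1, by norm_num, by norm_num⟩
  have hs : tsupport (f.normed volume) = Metric.closedBall 2 1 := f.tsupport_normed_eq
  have h0 : tsupport (f.normed volume) ⊆ Ioi 0 := by
    rw [hs, Real.closedBall_eq_Icc]
    intro x hx
    have := hx.1
    simp only [mem_Ioi]
    linarith
  refine ⟨f.normed volume, ⟨f.contDiff_normed, f.hasCompactSupport_normed, h0⟩, ?_⟩
  rw [setIntegral_eq_integral_of_forall_compl_eq_zero]
  · exact f.integral_normed
  · exact fun x hx => image_eq_zero_of_notMem_tsupport fun h => hx (h0 h)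

theorem ae_eq_zero_of_integral_isRealTest {f : ℝ → ℂ} (hf : LocallyIntegrableOn f (Ioi 0))
    (h : ∀ g, IsRealTest g → ∫ x, g x • f x ∂halfLine = 0) : ∀ᵐ x ∂halfLine, f x = 0 := by
  rw [ae_restrict_iff' measurableSet_Ioi]
  refine isOpen_Ioi.ae_eq_zero_of_integral_contDiff_smul_eq_zero hf fun g h1 h2 h3 => ?_
  rw [← h g ⟨h1, h2, h3⟩, setIntegral_eq_integral_of_forall_compl_eq_zero]
  intro x hx
  rw [image_eq_zero_of_notMem_tsupport fun h => hx (h3 h), zero_smul]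

theorem integrable_isRealTest {g : ℝ → ℝ} (hg : IsRealTest g) : Integrable g halfLine :=
  (hg.continuous.integrable_of_hasCompactSupport hg.2.1).restrict

theorem integral_smul_sub_right {f₁ f₂ : ℝ → ℂ} (h₁ : LocallyIntegrableOn f₁ (Ioi 0))
    (h₂ : LocallyIntegrableOn f₂ (Ioi 0)) {g : ℝ → ℝ} (hg : IsRealTest g) :
    ∫ x, g x • (f₁ - f₂) x ∂halfLine = (∫ x, g x • f₁ x ∂halfLine) - ∫ x, g x • f₂ x ∂halfLine := by
  rw [← integral_sub (integrable_smul_of_isRealTest h₁ hg) (integrable_smul_of_isRealTest h₂ hg)]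
  simp only [Pi.sub_apply, smul_sub]

theorem integral_smul_sub_left {f : ℝ → ℂ} (hf : LocallyIntegrableOn f (Ioi 0)) {g ρ : ℝ → ℝ}
    (hg : IsRealTest g) (hρ : IsRealTest ρ) (m : ℝ) :
    ∫ x, (g x - m * ρ x) • f x ∂halfLine
      = (∫ x, g x • f x ∂halfLine) - m • ∫ x, ρ x • f x ∂halfLine := by
  have hi : Integrable (fun x => m • ρ x • f x) halfLine :=
    (integrable_smul_of_isRealTest hf hρ).smul m
  rw [← integral_smul, ← integral_sub (integrable_smul_of_isRealTest hf hg) hi]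
  simp only [sub_smul, mul_smul]

/-- The lemma of du Bois-Reymond: a function whose weak derivative vanishes is constant. -/
theorem ae_eq_const_of_integral_deriv {f : ℝ → ℂ} (hf : LocallyIntegrableOn f (Ioi 0))
    (h : ∀ g, IsRealTest g → ∫ x, deriv g x • f x ∂halfLine = 0) :
    ∃ c : ℂ, ∀ᵐ x ∂halfLine, f x = c := by
  obtain ⟨ρ, hρ, hρ1⟩ := exists_isRealTest_integral_eq_one
  refine ⟨∫ x, ρ x • f x ∂halfLine, ?_⟩
  set c := ∫ x, ρ x • f x ∂halfLine with hc
  have hcl : LocallyIntegrableOn (fun _ : ℝ => c) (Ioi 0) :=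
    (continuous_const.locallyIntegrable).locallyIntegrableOn _
  have key := ae_eq_zero_of_integral_isRealTest (hf.sub hcl) fun g hg => ?_
  · filter_upwards [key] with x hx
    exact sub_eq_zero.1 hx
  · -- `g - (∫ g) ρ` has integral zero, hence is a derivative
    set m := ∫ x, g x ∂halfLine with hm
    obtain ⟨χ, hχ, hχd⟩ := (hg.sub (hρ.const_mul m)).exists_deriv_eq (by
      rw [integral_sub (integrable_isRealTest hg) (integrable_isRealTest (hρ.const_mul m)),
        integral_const_mul, hρ1, ← hm]
      ring)
    have e := h χ hχ
    rw [hχd] at e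
    have e1 : ∫ x, g x • f x ∂halfLine = m • c := by
      rw [← sub_eq_zero, hc, ← integral_smul_sub_left hf hg hρ, ← e]
    have e2 : ∫ x, g x • c ∂halfLine = m • c := by rw [integral_smul_const]
    rw [integral_smul_sub_right hf hcl hg, e1, e2, sub_self]

/-- Integration by parts against the primitive of a merely integrable function. -/
theorem integral_deriv_mul_primitive {h χ : ℝ → ℝ} {a b : ℝ} (h1 : (1 : ℝ) ∈ uIcc a b)
    (hh : IntervalIntegrable h volume a b) (hχ : ContDiff ℝ ∞ χ) (ha : χ a = 0) (hb : χ b = 0) :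
    ∫ x in a..b, deriv χ x * ∫ t in (1 : ℝ)..x, h t = -∫ x in a..b, χ x * h x := by
  have hF := hh.absolutelyContinuousOnInterval_intervalIntegral h1
  have hG : AbsolutelyContinuousOnInterval χ a b :=
    (hχ.of_le (by simp : (1 : WithTop ℕ∞) ≤ ∞)).contDiffOn.absolutelyContinuousOnInterval
  have e := hF.integral_mul_deriv_eq_deriv_mul hG
  rw [ha, hb] at e
  simp only [mul_zero, sub_zero, zero_sub] at e
  rw [show (∫ x in a..b, deriv χ x * ∫ t in (1 : ℝ)..x, h t)
    = ∫ x in a..b, (∫ t in (1 : ℝ)..x, h t) * deriv χ x from by simp_rw [mul_comm], e]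
  congr 1
  refine intervalIntegral.integral_congr_ae ?_
  filter_upwards [hh.ae_hasDerivAt_integral] with x hx hx'
  rw [(hx (uIoc_subset_uIcc hx') 1 h1).deriv, mul_comm]

theorem continuousOn_primitive {h : ℝ → ℂ} (hh : LocallyIntegrableOn h (Ioi 0)) :
    ContinuousOn (fun x => ∫ t in (1 : ℝ)..x, h t) (Ioi 0) := by
  intro x hx
  have hx : 0 < x := hx
  have hi : IntegrableOn h (uIcc (min (x / 2) 1) (max (2 * x) 1)) :=
    hh.integrableOn_compact_subset (fun t ht => lt_of_lt_of_le
      (lt_min (lt_min (by linarith) one_pos) (lt_max_of_lt_right one_pos)) ht.1) isCompact_uIcc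
  have hle : min (x / 2) 1 ≤ max (2 * x) 1 := (min_le_right _ _).trans (le_max_right _ _)
  have := intervalIntegral.continuousOn_primitive_interval' (a := 1) hi.intervalIntegrable
    (by rw [uIcc_of_le hle]; exact ⟨min_le_right _ _, le_max_right _ _⟩)
  rw [uIcc_of_le hle] at this
  refine (this.continuousAt (Icc_mem_nhds ?_ ?_)).continuousWithinAt
  · exact lt_of_le_of_lt (min_le_left _ _) (by linarith)
  · exact lt_of_lt_of_le (by linarith) (le_max_left _ _)

theorem integral_deriv_smul_primitive {h : ℝ → ℂ} (hh : LocallyIntegrableOn h (Ioi 0))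
    {χ : ℝ → ℝ} (hχ : IsRealTest χ) :
    ∫ x, deriv χ x • (∫ t in (1 : ℝ)..x, h t) ∂halfLine = -∫ x, χ x • h x ∂halfLine := by
  obtain ⟨a, b, ha, ha1, hb, hs⟩ := hχ.exists_Icc
  have h0 : ∀ x, x ∉ Ioo a b → χ x = 0 := fun x hx =>
    image_eq_zero_of_notMem_tsupport fun h' => hx (hs h')
  have hab : a ≤ b := by linarith
  have hu : uIcc a b = Icc a b := uIcc_of_le hab
  obtain ⟨hs0, hs1⟩ : χ a = 0 ∧ χ b = 0 := ⟨h0 a (by simp), h0 b (by simp)⟩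
  have hd0 : ∀ x, x ∉ Ioo a b → deriv χ x = 0 := fun x hx =>
    by_contra fun hne => hx (hs (support_deriv_subset hne))
  rw [integral_halfLine_eq_intervalIntegral ha hab (fun x hx => by rw [hd0 x hx, zero_smul]),
    integral_halfLine_eq_intervalIntegral ha hab (fun x hx => by rw [h0 x hx, zero_smul])]
  have hI : IntervalIntegrable h volume a b :=
    intervalIntegrable_of_locallyIntegrableOn hh ha (by linarith)
  have hI1 : IntervalIntegrable (fun x => χ x • h x) volume a b :=
    hI.continuousOn_smul hχ.continuous.continuousOn
  have hI2 : IntervalIntegrable (fun x => deriv χ x • ∫ t in (1 : ℝ)..x, h t) volume a b := by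
    refine ContinuousOn.intervalIntegrable (hχ.deriv.continuous.continuousOn.smul
      ((continuousOn_primitive hh).mono fun x hx => ?_))
    rw [hu] at hx
    exact ha.trans_le hx.1
  have h1 : (1 : ℝ) ∈ uIcc a b := by rw [hu]; exact ⟨ha1.le, hb.le⟩
  have aux : ∀ L : ℂ →L[ℝ] ℝ, L (∫ x in a..b, deriv χ x • ∫ t in (1 : ℝ)..x, h t)
      = L (-∫ x in a..b, χ x • h x) := by
    intro L
    have hL : IntervalIntegrable (fun x => L (h x)) volume a b :=
      ⟨L.integrable_comp hI.1, L.integrable_comp hI.2⟩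
    rw [map_neg, ← L.intervalIntegral_comp_comm hI1, ← L.intervalIntegral_comp_comm hI2]
    simp only [map_smul, smul_eq_mul]
    rw [← integral_deriv_mul_primitive h1 hL hχ.1 hs0 hs1]
    refine intervalIntegral.integral_congr fun x hx => ?_
    rw [hu] at hx
    rw [L.intervalIntegral_comp_comm
      (intervalIntegrable_of_locallyIntegrableOn hh one_pos (ha.trans_le hx.1))]
  exact Complex.ext (aux Complex.reCLM) (aux Complex.imCLM)

theorem locallyIntegrableOn_of_continuousOn {f : ℝ → ℂ} (hf : ContinuousOn f (Ioi 0)) :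
    LocallyIntegrableOn f (Ioi 0) :=
  hf.locallyIntegrableOn measurableSet_Ioi

/-- A function whose second weak derivative vanishes is affine: for a test function `ρ` with
integral one, its weak derivative is the constant `d = -∫ f ρ'`. -/
theorem ae_eq_affine_of_integral_deriv_deriv {f : ℝ → ℂ} (hf : LocallyIntegrableOn f (Ioi 0))
    (h : ∀ g, IsRealTest g → ∫ x, deriv (deriv g) x • f x ∂halfLine = 0) :
    ∃ c d : ℂ, ∀ᵐ x ∂halfLine, f x = c + d * x := by
  obtain ⟨ρ, hρ, hρ1⟩ := exists_isRealTest_integral_eq_one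
  set d := -∫ x, deriv ρ x • f x ∂halfLine with hd
  have hl : LocallyIntegrableOn (fun x : ℝ => ∫ _ in (1 : ℝ)..x, d) (Ioi 0) :=
    locallyIntegrableOn_of_continuousOn (continuousOn_primitive
      ((continuous_const.locallyIntegrable).locallyIntegrableOn _))
  obtain ⟨c, hc⟩ := ae_eq_const_of_integral_deriv (hf.sub hl) fun g hg => by
    set m := ∫ x, g x ∂halfLine with hm
    obtain ⟨χ, hχ, hχd⟩ := (hg.sub (hρ.const_mul m)).exists_deriv_eq (by
      rw [integral_sub (integrable_isRealTest hg) (integrable_isRealTest (hρ.const_mul m)),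
        integral_const_mul, hρ1, ← hm]
      ring)
    have e := h χ hχ
    rw [hχd] at e
    have e1 : ∫ x, deriv g x • f x ∂halfLine = -(m • d) := by
      have : deriv (fun x => g x - m * ρ x) = fun x => deriv g x - m * deriv ρ x := by
        funext x
        rw [deriv_fun_sub (hg.differentiable x) ((hρ.const_mul m).differentiable x),
          deriv_const_mul _ (hρ.differentiable x)]
      rw [hd, smul_neg, neg_neg, ← sub_eq_zero, ← integral_smul_sub_left hf hg.deriv hρ.deriv, ← e,
        this]
    have e2 : ∫ x, deriv g x • (∫ _ in (1 : ℝ)..x, d) ∂halfLine = -(m • d) := by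
      rw [integral_deriv_smul_primitive
        ((continuous_const.locallyIntegrable).locallyIntegrableOn _) hg, integral_smul_const]
    rw [integral_smul_sub_right hf hl hg.deriv, e1, e2, sub_self]
  refine ⟨c - d, d, ?_⟩
  filter_upwards [hc] with x hx
  simp only [Pi.sub_apply, intervalIntegral.integral_const, Complex.real_smul] at hx
  rw [← sub_eq_zero] at hx ⊢
  rw [← hx]
  push_cast
  ring

/-- Weak solutions of `ψ'' = Q ψ` with continuous `Q` are classical solutions, as they differ from
the second primitive of `Q ψ` by an affine function. -/
theorem exists_hasDerivAt_of_weak {Q ψ : ℝ → ℂ} (hQ : ContinuousOn Q (Ioi 0))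
    (hψ : LocallyIntegrableOn ψ (Ioi 0))
    (h : ∀ χ, IsRealTest χ → ∫ x, deriv (deriv χ) x • ψ x ∂halfLine
      = ∫ x, χ x • (Q x * ψ x) ∂halfLine) :
    ∃ ψ₀ ψ₁ : ℝ → ℂ, ψ =ᵐ[halfLine] ψ₀ ∧
      ∀ x > 0, HasDerivAt ψ₀ (ψ₁ x) x ∧ HasDerivAt ψ₁ (Q x * ψ₀ x) x := by
  have hQψ : LocallyIntegrableOn (fun x => Q x * ψ x) (Ioi 0) :=
    hψ.continuousOn_mul hQ isOpen_Ioi.isLocallyClosed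
  have hF := continuousOn_primitive hQψ
  have hFl := locallyIntegrableOn_of_continuousOn hF
  have hP := continuousOn_primitive hFl
  have hPl := locallyIntegrableOn_of_continuousOn hP
  obtain ⟨c, d, hcd⟩ := ae_eq_affine_of_integral_deriv_deriv (hψ.sub hPl) fun g hg => by
    have e1 := h g hg
    have e2 := integral_deriv_smul_primitive hFl hg.deriv
    rw [integral_deriv_smul_primitive hQψ hg, neg_neg, ← e1] at e2
    rw [integral_smul_sub_right hψ hPl hg.deriv.deriv, e2, sub_self]
  set F := fun x => ∫ t in (1 : ℝ)..x, Q t * ψ t with hFdef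
  set ψ₀ : ℝ → ℂ := fun x => (∫ t in (1 : ℝ)..x, F t) + (c + d * x) with hψ₀
  have hae : ψ =ᵐ[halfLine] ψ₀ := by
    filter_upwards [hcd] with x hx
    rw [← sub_eq_zero] at hx ⊢
    rw [← hx]
    simp only [hψ₀, Pi.sub_apply]
    ring
  have hprim : ∀ {u : ℝ → ℂ}, ContinuousOn u (Ioi 0) → ∀ x > 0,
      HasDerivAt (fun x => ∫ t in (1 : ℝ)..x, u t) (u x) x := fun {u} hu x hx =>
    intervalIntegral.integral_hasDerivAt_right
      (intervalIntegrable_of_locallyIntegrableOn (locallyIntegrableOn_of_continuousOn hu)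
        one_pos hx)
      (hu.stronglyMeasurableAtFilter isOpen_Ioi x hx) (hu.continuousAt (Ioi_mem_nhds hx))
  have hd0 : ∀ x > 0, HasDerivAt ψ₀ (F x + d) x := fun x hx => by
    have h2 : HasDerivAt (fun x : ℝ => c + d * (x : ℂ)) d x := by
      simpa using ((Complex.ofRealCLM.hasDerivAt (x := x)).const_mul d).const_add c
    exact (hprim hF x hx).add h2
  have hc0 : ContinuousOn ψ₀ (Ioi 0) := fun x hx => (hd0 x hx).continuousAt.continuousWithinAt
  refine ⟨ψ₀, fun x => F x + d, hae, fun x hx => ⟨hd0 x hx, ?_⟩⟩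
  have hFeq : ∀ y > 0, F y = ∫ t in (1 : ℝ)..y, Q t * ψ₀ t := fun y hy => by
    refine intervalIntegral.integral_congr_ae ?_
    rw [Filter.EventuallyEq, ae_restrict_iff' measurableSet_Ioi] at hae
    filter_upwards [hae] with t ht ht'
    have : t ∈ Ioi (0 : ℝ) := lt_of_le_of_lt (le_min one_pos.le hy.le) ht'.1
    rw [ht this]
  refine HasDerivAt.add_const _ ((hprim (hQ.mul hc0) x hx).congr_of_eventuallyEq ?_)
  filter_upwards [Ioi_mem_nhds hx] with y hy using hFeq y hy

/-! ### The regular solution -/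

/-- The integral kernel `t (1 - t^{2ν}) / (2ν)` of the Volterra equation for the regular solution,
rescaled to the interval `[0, 1]`. -/
def volterraKernel (ν t : ℝ) : ℂ := ((t * (1 - t ^ (2 * ν)) / (2 * ν) : ℝ) : ℂ)

/-- The mean `∫₀¹ k(t) q(xt) g(xt) dt` in the Volterra equation
`g = 1 + x² ∫₀¹ k(t) q(xt) g(xt) dt`,
which says that `x^{1/2 + ν} g(x)` solves `-φ'' + ((ν² - 1/4) / x² + q) φ = 0`. -/
def volterraMean (ν : ℝ) (q g : ℝ → ℂ) (x : ℝ) : ℂ :=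
  ∫ t in (0 : ℝ)..1, volterraKernel ν t * (q (x * t) * g (x * t))

theorem continuous_volterraKernel {ν : ℝ} (hν : 0 < ν) : Continuous (volterraKernel ν) := by
  have : Continuous fun t : ℝ => t ^ (2 * ν) :=
    continuous_id.rpow_const fun x => Or.inr (by positivity)
  unfold volterraKernel
  fun_prop

theorem norm_volterraKernel_le {ν : ℝ} (hν : 0 < ν) {t : ℝ} (h0 : 0 ≤ t) (h1 : t ≤ 1) :
    ‖volterraKernel ν t‖ ≤ t / (2 * ν) := by
  have ha : t ^ (2 * ν) ≤ 1 := Real.rpow_le_one h0 h1 (by positivity)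
  have hb : 0 ≤ t ^ (2 * ν) := Real.rpow_nonneg h0 _
  rw [volterraKernel, Complex.norm_real, Real.norm_of_nonneg
    (div_nonneg (mul_nonneg h0 (by linarith)) (by positivity))]
  gcongr
  nlinarith

theorem continuous_volterraMean {ν : ℝ} (hν : 0 < ν) {q g : ℝ → ℂ} (hq : Continuous q)
    (hg : Continuous g) : Continuous (volterraMean ν q g) := by
  have := continuous_volterraKernel hν
  unfold volterraMean
  apply intervalIntegral.continuous_parametric_intervalIntegral_of_continuous'
  simp only [Function.uncurry_def]
  fun_prop

/-- The successive approximations to the solution of the Volterra equation. -/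
def volterraIterate (ν : ℝ) (q : ℝ → ℂ) : ℕ → ℝ → ℂ
  | 0 => fun _ => 1
  | n + 1 => fun x => x ^ 2 * volterraMean ν q (volterraIterate ν q n) x

theorem continuous_volterraIterate {ν : ℝ} (hν : 0 < ν) {q : ℝ → ℂ} (hq : Continuous q) (n : ℕ) :
    Continuous (volterraIterate ν q n) := by
  induction n with
  | zero => exact continuous_const
  | succ n ih =>
    have := continuous_volterraMean hν hq ih
    simp only [volterraIterate]
    fun_prop

/-- The factorial comes from `∫₀¹ t t^{2n} dt = 1 / (2n + 2)`. -/
theorem norm_volterraIterate_le {ν : ℝ} (hν : 0 < ν) {q : ℝ → ℂ} {X M : ℝ} (hM0 : 0 ≤ M)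
    (hM : ∀ y, |y| ≤ X → ‖q y‖ ≤ M) (n : ℕ) {x : ℝ} (hx : |x| ≤ X) :
    ‖volterraIterate ν q n x‖ ≤ (M / (4 * ν)) ^ n * x ^ (2 * n) / n.factorial := by
  induction n generalizing x with
  | zero => simp [volterraIterate]
  | succ n ih =>
    have hb : ‖volterraMean ν q (volterraIterate ν q n) x‖ ≤
        ∫ t in (0 : ℝ)..1, (M / (2 * ν) * ((M / (4 * ν)) ^ n * x ^ (2 * n) / n.factorial))
          * t ^ (2 * n + 1) := by
      refine intervalIntegral.norm_integral_le_of_norm_le zero_le_one (.of_forall fun t ht => ?_)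
        (Continuous.intervalIntegrable (by fun_prop) _ _)
      have hxt : |x * t| ≤ X := by
        rw [abs_mul, abs_of_pos ht.1]
        exact (mul_le_of_le_one_right (abs_nonneg _) ht.2).trans hx
      rw [norm_mul, norm_mul]
      calc _ ≤ t / (2 * ν) * (M * ((M / (4 * ν)) ^ n * (x * t) ^ (2 * n) / n.factorial)) := by
            have : 0 ≤ t / (2 * ν) := div_nonneg ht.1.le (by positivity)
            gcongr
            · exact norm_volterraKernel_le hν ht.1.le ht.2
            · exact hM _ hxt
            · exact ih hxt
        _ = _ := by ring
    rw [intervalIntegral.integral_const_mul, integral_pow] at hb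
    simp only [volterraIterate, norm_mul, norm_pow, Complex.norm_real, Real.norm_eq_abs, sq_abs]
    calc _ ≤ x ^ 2 * _ := mul_le_mul_of_nonneg_left hb (sq_nonneg x)
      _ = _ := by
        rw [Nat.factorial_succ]
        push_cast
        have : (n : ℝ) + 1 ≠ 0 := by positivity
        have : (2 : ℝ) * n + 1 + 1 ≠ 0 := by positivity
        have : (n.factorial : ℝ) ≠ 0 := by positivity
        rw [show M / (2 * ν) = 2 * (M / (4 * ν)) by ring]
        generalize M / (4 * ν) = c
        field_simp
        ring

theorem exists_volterra_solution {ν : ℝ} (hν : 0 < ν) {q : ℝ → ℂ} (hq : Continuous q) :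
    ∃ g : ℝ → ℂ, Continuous g ∧ ∀ x : ℝ, g x = 1 + x ^ 2 * volterraMean ν q g x := by
  set u := volterraIterate ν q
  have hu := continuous_volterraIterate hν hq
  have hbd : ∀ X : ℝ, ∃ B : ℕ → ℝ, Summable B ∧ ∀ n, ∀ x, |x| ≤ X → ‖u n x‖ ≤ B n := by
    intro X
    obtain ⟨M, hM⟩ := (isCompact_Icc (a := -X) (b := X)).exists_bound_of_continuousOn
      hq.continuousOn
    refine ⟨fun n => ((max M 0) / (4 * ν) * X ^ 2) ^ n / n.factorial,
      Real.summable_pow_div_factorial _, fun n x hx => ?_⟩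
    refine (norm_volterraIterate_le hν (le_max_right M 0)
      (fun y hy => (hM y (abs_le.1 hy)).trans (le_max_left _ _)) n hx).trans ?_
    have : x ^ (2 * n) ≤ X ^ (2 * n) := by
      rw [pow_mul, pow_mul, ← sq_abs x]
      gcongr
    calc _ ≤ (max M 0 / (4 * ν)) ^ n * X ^ (2 * n) / n.factorial := by gcongr
      _ = (max M 0 / (4 * ν) * X ^ 2) ^ n / n.factorial := by rw [mul_pow, ← pow_mul]
  have hsum : ∀ x, Summable fun n => u n x := fun x => by
    obtain ⟨B, hB, hB'⟩ := hbd |x|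
    exact .of_norm_bounded hB fun n => hB' n x le_rfl
  have hc : Continuous fun x => ∑' n, u n x := by
    rw [continuous_iff_continuousAt]
    intro x
    obtain ⟨B, hB, hB'⟩ := hbd (|x| + 1)
    refine (continuousOn_tsum (s := Icc (-(|x| + 1)) (|x| + 1)) (fun n => (hu n).continuousOn) hB
      fun n y hy => hB' n y (abs_le.2 hy)).continuousAt (Icc_mem_nhds ?_ ?_)
    · linarith [neg_abs_le x]
    · linarith [le_abs_self x]
  refine ⟨fun x => ∑' n, u n x, hc, fun x => ?_⟩
  have hmean : HasSum (fun n => volterraMean ν q (u n) x)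
      (volterraMean ν q (fun x => ∑' n, u n x) x) := by
    obtain ⟨B, hB, hB'⟩ := hbd |x|
    obtain ⟨M, hM⟩ := (isCompact_Icc (a := (0 : ℝ)) (b := 1)).exists_bound_of_continuousOn
      (f := fun t => volterraKernel ν t * q (x * t))
      ((continuous_volterraKernel hν).mul (hq.comp (by fun_prop))).continuousOn
    refine intervalIntegral.hasSum_integral_of_dominated_convergence (fun n _ => max M 0 * B n)
      (fun n => ?_) (fun n => .of_forall fun t ht => ?_)
      (.of_forall fun t _ => hB.mul_left _) (by simp) (.of_forall fun t ht => ?_)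
    · have := continuous_volterraKernel hν
      have := hu n
      exact Continuous.aestronglyMeasurable (by fun_prop)
    · rw [uIoc_of_le zero_le_one] at ht
      rw [← mul_assoc, norm_mul]
      have h1 := (hM t ⟨ht.1.le, ht.2⟩).trans (le_max_left M 0)
      have h2 := hB' n (x * t) (by
        rw [abs_mul, abs_of_pos ht.1]
        exact mul_le_of_le_one_right (abs_nonneg _) ht.2)
      gcongr
    · simp_rw [← mul_assoc]
      exact (hsum _).hasSum.mul_left _
  have h1 := (hsum x).tsum_eq_zero_add
  simp only [h1, u, volterraIterate]
  congr 1
  rw [← hmean.tsum_eq, tsum_mul_left]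

theorem hasDerivAt_ofReal_rpow (s : ℝ) {x : ℝ} (hx : 0 < x) :
    HasDerivAt (fun y : ℝ => ((y ^ s : ℝ) : ℂ)) ((s * x ^ (s - 1) : ℝ) : ℂ) x :=
  (Real.hasDerivAt_rpow_const (Or.inl hx.ne')).ofReal_comp

theorem continuous_bPlus {ν : ℝ} (hν : 0 < ν) : Continuous (bPlus ν) :=
  Complex.continuous_ofReal.comp (continuous_id.rpow_const fun x => Or.inr (by positivity))

/-- The regular solution `φ = x^{1/2 + ν} + O(x^{3/2})` of `φ'' = ((ν² - 1/4) / x² + q) φ`, namely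
`x^{1/2 + ν} g(x)` with `g` the solution of the Volterra equation. -/
theorem exists_regular_solution {ν : ℝ} (hν : 0 < ν) {q : ℝ → ℂ} (hq : Continuous q) :
    ∃ φ φ₁ : ℝ → ℂ, Continuous φ ∧ IsRemainder (fun x => φ x - bPlus ν x) ∧
      ∀ x > 0, HasDerivAt φ (φ₁ x) x ∧
        HasDerivAt φ₁ ((((ν ^ 2 - 1 / 4) / x ^ 2 : ℝ) + q x) * φ x) x := by
  obtain ⟨g, hg, hge⟩ := exists_volterra_solution hν hq
  set p : ℝ → ℂ := fun y => q y * g y with hp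
  have hpc : Continuous p := hq.mul hg
  set a : ℝ → ℂ := fun x => ∫ y in (0 : ℝ)..x, (y : ℂ) * p y with ha
  set b : ℝ → ℂ := fun x => ∫ y in (0 : ℝ)..x, ((y ^ (1 + 2 * ν) : ℝ) : ℂ) * p y with hb
  have hac : Continuous fun y : ℝ => (y : ℂ) * p y := by fun_prop
  have hbc : Continuous fun y : ℝ => ((y ^ (1 + 2 * ν) : ℝ) : ℂ) * p y :=
    (Complex.continuous_ofReal.comp
      (continuous_id.rpow_const fun x => Or.inr (by positivity))).mul hpc
  have had : ∀ x, HasDerivAt a (x * p x) x := fun x =>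
    intervalIntegral.integral_hasDerivAt_right (hac.intervalIntegrable _ _)
      (hac.stronglyMeasurableAtFilter _ _) hac.continuousAt
  have hbd : ∀ x, HasDerivAt b (((x ^ (1 + 2 * ν) : ℝ) : ℂ) * p x) x := fun x =>
    intervalIntegral.integral_hasDerivAt_right (hbc.intervalIntegrable _ _)
      (hbc.stronglyMeasurableAtFilter _ _) hbc.continuousAt
  have hν' : (ν : ℂ) ≠ 0 := by exact_mod_cast hν.ne'
  -- the substitution `y = x t` turns the Volterra equation into the variation of constants formula
  have hm : ∀ x : ℝ, 0 < x → (x : ℂ) ^ 2 * volterraMean ν q g x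
      = (a x - ((x ^ (-(2 * ν)) : ℝ) : ℂ) * b x) / (2 * ν) := by
    intro x hx
    have hx' : (x : ℂ) ≠ 0 := by exact_mod_cast hx.ne'
    set F : ℝ → ℂ := fun y => (1 / (2 * ν * x) : ℂ) *
      ((y : ℂ) * p y - ((x ^ (-(2 * ν)) : ℝ) : ℂ) * (((y ^ (1 + 2 * ν) : ℝ) : ℂ) * p y)) with hF
    have e : volterraMean ν q g x = ∫ t in (0 : ℝ)..1, F (x * t) := by
      refine intervalIntegral.integral_congr fun t ht => ?_
      rw [uIcc_of_le zero_le_one] at ht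
      simp only [volterraKernel, hp, hF]
      have h1 : (x * t) ^ (1 + 2 * ν) = x * x ^ (2 * ν) * (t * t ^ (2 * ν)) := by
        rw [Real.mul_rpow hx.le ht.1, Real.rpow_add hx, Real.rpow_one,
          Real.rpow_add_of_nonneg ht.1 zero_le_one (by positivity), Real.rpow_one]
      have h2 : x ^ (2 * ν) ≠ 0 := (Real.rpow_pos_of_pos hx _).ne'
      have h2' : ((x ^ (2 * ν) : ℝ) : ℂ) ≠ 0 := by exact_mod_cast h2
      rw [h1, Real.rpow_neg hx.le]
      push_cast
      field_simp
    have hbi : IntervalIntegrable (fun y : ℝ => ((x ^ (-(2 * ν)) : ℝ) : ℂ) *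
        (((y ^ (1 + 2 * ν) : ℝ) : ℂ) * p y)) volume (x * 0) (x * 1) :=
      (continuous_const.mul hbc).intervalIntegrable _ _
    rw [e, intervalIntegral.integral_comp_mul_left F hx.ne', hF,
      intervalIntegral.integral_const_mul,
      intervalIntegral.integral_sub (hac.intervalIntegrable _ _) hbi,
      intervalIntegral.integral_const_mul, mul_zero, mul_one, Complex.real_smul]
    simp only [ha, hb]
    push_cast
    field_simp
  set φ : ℝ → ℂ := fun x => bPlus ν x * g x with hφ
  have hφe : ∀ x : ℝ, 0 < x → φ x = bPlus ν x + (bPlus ν x * a x - bMinus ν x * b x) / (2 * ν) := by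
    intro x hx
    simp only [hφ]
    rw [hge, hm x hx]
    have : bMinus ν x = bPlus ν x * ((x ^ (-(2 * ν)) : ℝ) : ℂ) := by
      rw [bMinus, bPlus, ← Complex.ofReal_mul, ← Real.rpow_add hx]
      congr 2
      ring
    rw [this]
    ring
  refine ⟨φ, fun x => (((1 / 2 + ν) * x ^ (1 / 2 + ν - 1) : ℝ) : ℂ) * (1 + a x / (2 * ν))
    - (((1 / 2 - ν) * x ^ (1 / 2 - ν - 1) : ℝ) : ℂ) * (b x / (2 * ν)),
    (continuous_bPlus hν).mul hg, ?_, fun x hx => ⟨?_, ?_⟩⟩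
  · have hr : (fun x : ℝ => volterraMean ν q g x * ((x ^ (1 + ν) : ℝ) : ℂ)) =O[𝓝[>] (0 : ℝ)]
        fun _ => (1 : ℝ) := by
      refine (Filter.Tendsto.isBigO_one ℝ (ContinuousAt.tendsto (x := (0 : ℝ)) ?_)).mono
        nhdsWithin_le_nhds
      exact ((continuous_volterraMean hν hq hg).mul (Complex.continuous_ofReal.comp
        (continuous_id.rpow_const fun x => Or.inr (by positivity)))).continuousAt
    have := hr.mul (Complex.isBigO_ofReal_left.2
      (isBigO_refl (fun x : ℝ => x ^ (3 / 2 : ℝ)) (𝓝[>] 0)))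
    simp only [one_mul] at this
    refine this.congr' ?_ .rfl
    filter_upwards [self_mem_nhdsWithin] with x hx
    have hx : 0 < x := hx
    have h2 : x ^ (1 + ν) * x ^ (3 / 2 : ℝ) = x ^ (1 / 2 + ν) * x ^ 2 := by
      rw [← Real.rpow_natCast, ← Real.rpow_add hx, ← Real.rpow_add hx]
      congr 1
      push_cast
      ring
    have h2' : ((x ^ (1 + ν) : ℝ) : ℂ) * ((x ^ (3 / 2 : ℝ) : ℝ) : ℂ)
        = ((x ^ (1 / 2 + ν) : ℝ) : ℂ) * (x : ℂ) ^ 2 := by exact_mod_cast h2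
    simp only [hφ]
    rw [hge x, mul_assoc, h2', bPlus]
    ring
  all_goals
    have hS : 0 < x ^ (1 / 2 : ℝ) := Real.rpow_pos_of_pos hx _
    have hN : 0 < x ^ ν := Real.rpow_pos_of_pos hx _
    have hxS : x = (x ^ (1 / 2 : ℝ)) ^ 2 := by
      rw [← Real.rpow_natCast, ← Real.rpow_mul hx.le]
      norm_num
    have hNN : x ^ (2 * ν) = (x ^ ν) ^ 2 := by
      rw [← Real.rpow_natCast, ← Real.rpow_mul hx.le]
      congr 1
      push_cast
      ring
  · refine HasDerivAt.congr_of_eventuallyEq (f := fun x => bPlus ν x +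
      (bPlus ν x * a x - bMinus ν x * b x) / (2 * ν)) ?_ ?_
    · have h1 := hasDerivAt_ofReal_rpow (1 / 2 + ν) hx
      have h2 := hasDerivAt_ofReal_rpow (1 / 2 - ν) hx
      refine (h1.add (((h1.mul (had x)).sub (h2.mul (hbd x))).div_const (2 * ν))).congr_deriv ?_
      simp only [Real.rpow_add hx, Real.rpow_sub hx, Real.rpow_one, hNN]
      set S := x ^ (1 / 2 : ℝ)
      set N := x ^ ν
      rw [hxS]
      have hS' : (S : ℂ) ≠ 0 := by exact_mod_cast hS.ne'
      have hN' : (N : ℂ) ≠ 0 := by exact_mod_cast hN.ne'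
      push_cast
      field_simp
      ring
    · filter_upwards [Ioi_mem_nhds hx] with y hy using hφe y hy
  · have h1 := (hasDerivAt_ofReal_rpow (1 / 2 + ν - 1) hx).const_mul ((1 / 2 + ν : ℝ) : ℂ)
    have h2 := (hasDerivAt_ofReal_rpow (1 / 2 - ν - 1) hx).const_mul ((1 / 2 - ν : ℝ) : ℂ)
    have h3 := (h1.mul (((had x).div_const (2 * ν)).const_add 1)).sub
      (h2.mul ((hbd x).div_const (2 * ν)))
    have e : (((ν ^ 2 - 1 / 4) / x ^ 2 : ℝ) + q x) * φ x = ((ν ^ 2 - 1 / 4) / x ^ 2 : ℝ)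
        * (bPlus ν x + (bPlus ν x * a x - bMinus ν x * b x) / (2 * ν)) + p x * bPlus ν x := by
      rw [← hφe x hx]
      simp only [hφ, hp]
      ring
    rw [e]
    simp only [← mul_assoc, ← Complex.ofReal_mul] at h3
    refine h3.congr_deriv ?_
    simp only [bPlus, bMinus, Real.rpow_add hx, Real.rpow_sub hx, Real.rpow_one, hNN]
    set S := x ^ (1 / 2 : ℝ)
    set N := x ^ ν
    rw [hxS]
    have hS' : (S : ℂ) ≠ 0 := by exact_mod_cast hS.ne'
    have hN' : (N : ℂ) ≠ 0 := by exact_mod_cast hN.ne'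
    push_cast
    field_simp
    ring

/-! ### The adjoint as a weak differential operator -/

theorem IsTest.deriv {χ : ℝ → ℂ} (hχ : IsTest χ) : IsTest (deriv χ) :=
  ⟨(contDiff_infty_iff_deriv.1 hχ.1).2, hχ.2.1.deriv,
    (closure_mono support_deriv_subset).trans ((closure_closure).subset.trans hχ.2.2)⟩

theorem IsTest.eq_zero {χ : ℝ → ℂ} (hχ : IsTest χ) {x : ℝ} (hx : x ∉ Ioi (0 : ℝ)) : χ x = 0 :=
  image_eq_zero_of_notMem_tsupport fun h => hx (hχ.2.2 h)

theorem IsTest.star {χ : ℝ → ℂ} (hχ : IsTest χ) : IsTest (fun x => star (χ x)) := by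
  have hs : Function.support (fun x => Star.star (χ x)) = Function.support χ := by
    ext x
    simp
  have ht : tsupport (fun x => Star.star (χ x)) = tsupport χ := by rw [tsupport, hs, tsupport]
  refine ⟨(Complex.conjCLE : ℂ ≃L[ℝ] ℂ).contDiff.comp hχ.1, ?_, ht.symm ▸ hχ.2.2⟩
  rw [HasCompactSupport, ht]
  exact hχ.2.1

theorem IsTest.expr_star (ν : ℝ) (V : ℝ → ℝ) (χ : ℝ → ℂ) (x : ℝ) :
    expr ν V (fun y => Star.star (χ y)) x = Star.star (expr ν V χ x) := by
  have h : _root_.deriv (fun y => Star.star (χ y)) = fun y => Star.star (_root_.deriv χ y) :=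
    funext fun y => deriv.star
  rw [expr, h, deriv.star, expr]
  simp

theorem IsRealTest.isTest {g : ℝ → ℝ} (hg : IsRealTest g) : IsTest (fun x => (g x : ℂ)) := by
  have hs : Function.support (fun x => (g x : ℂ)) = Function.support g := by
    ext x
    simp
  have ht : tsupport (fun x => (g x : ℂ)) = tsupport g := by rw [tsupport, hs, tsupport]
  refine ⟨Complex.ofRealCLM.contDiff.comp hg.1, ?_, ht.symm ▸ hg.2.2⟩
  rw [HasCompactSupport, ht]
  exact hg.2.1

/-- The product of a function continuous on the open half-line and a test function is continuous
on the line, whatever junk values the first factor has outside the half-line. -/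
theorem IsTest.continuous_mul {χ c : ℝ → ℂ} (hχ : IsTest χ) (hc : ContinuousOn c (Ioi 0)) :
    Continuous fun x => c x * χ x :=
  (hc.mul hχ.1.continuous.continuousOn).continuous_of_tsupport_subset isOpen_Ioi
    ((tsupport_mul_subset_right (f := c) (g := χ)).trans hχ.2.2)

theorem IsTest.integrable_mul {χ c : ℝ → ℂ} (hχ : IsTest χ) (hc : ContinuousOn c (Ioi 0)) :
    Integrable (fun x => c x * χ x) :=
  (hχ.continuous_mul hc).integrable_of_hasCompactSupport hχ.2.1.mul_left

theorem IsTest.memLp {χ : ℝ → ℂ} (hχ : IsTest χ) : MemLp χ 2 halfLine :=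
  hχ.1.continuous.memLp_of_hasCompactSupport hχ.2.1

theorem continuousOn_potential (ν : ℝ) {V : ℝ → ℝ} (hV : ContinuousOn V (Ioi 0)) :
    ContinuousOn (fun x => (((ν ^ 2 - 1 / 4) / x ^ 2 + V x : ℝ) : ℂ)) (Ioi 0) := by
  refine Complex.continuous_ofReal.comp_continuousOn (ContinuousOn.add ?_ hV)
  exact continuousOn_const.div (by fun_prop) fun x hx => pow_ne_zero 2 (ne_of_gt hx)

theorem IsTest.memLp_expr {ν : ℝ} {V : ℝ → ℝ} (hV : ContinuousOn V (Ioi 0)) {χ : ℝ → ℂ}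
    (hχ : IsTest χ) : MemLp (expr ν V χ) 2 halfLine :=
  MemLp.add (f := fun x => -_root_.deriv (_root_.deriv χ) x) hχ.deriv.deriv.memLp.neg
    ((hχ.continuous_mul (continuousOn_potential ν hV)).memLp_of_hasCompactSupport hχ.2.1.mul_left)

theorem locallyIntegrableOn_of_memLp {u : ℝ → ℂ} (hu : MemLp u 2 halfLine) :
    LocallyIntegrableOn u (Ioi 0) := by
  rw [locallyIntegrableOn_iff isOpen_Ioi.isLocallyClosed]
  intro k hk hkc
  have h1 : MemLp u 2 (volume.restrict k) := hu.mono_measure (Measure.restrict_mono hk le_rfl)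
  have : IsFiniteMeasure (volume.restrict k) := ⟨by simpa using hkc.measure_lt_top⟩
  exact h1.integrable (by norm_num)

theorem mem_minGraph_of_isTest {ν : ℝ} {V : ℝ → ℝ} (hV : ContinuousOn V (Ioi 0)) {χ : ℝ → ℂ}
    (hχ : IsTest χ) : (hχ.memLp.toLp χ, (hχ.memLp_expr (ν := ν) hV).toLp _) ∈ minGraph ν V :=
  ⟨χ, hχ, hχ.memLp.coeFn_toLp, (hχ.memLp_expr hV).coeFn_toLp⟩

theorem inner_eq_integral_star (u v : H) :
    inner ℂ u v = star (∫ x, u x * star (v x) ∂halfLine) := by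
  rw [L2.inner_def, Complex.star_def, ← integral_conj]
  refine integral_congr_ae (.of_forall fun x => ?_)
  simp [RCLike.inner_apply, mul_comm]

/-- The (classes of) test functions are dense in `L²`. -/
theorem dense_domain_A (ν : ℝ) {V : ℝ → ℝ} (hV : ContinuousOn V (Ioi 0)) :
    Dense ((A ν V).domain : Set H) := by
  rw [Submodule.dense_iff_topologicalClosure_eq_top, Submodule.topologicalClosure_eq_top_iff,
    Submodule.eq_bot_iff]
  intro u hu
  rw [Submodule.mem_orthogonal'] at hu
  rw [Lp.eq_zero_iff_ae_eq_zero]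
  refine ae_eq_zero_of_integral_isRealTest (locallyIntegrableOn_of_memLp (Lp.memLp u))
    fun g hg => ?_
  have hgt := hg.isTest
  have hmem : hgt.memLp.toLp _ ∈ (A ν V).domain := by
    rw [LinearPMap.mem_domain_iff]
    exact ⟨_, by rw [A_graph]; exact mem_minGraph_of_isTest hV hgt⟩
  have := hu _ hmem
  rw [inner_eq_integral_star, star_eq_zero] at this
  rw [← this]
  refine integral_congr_ae ?_
  filter_upwards [hgt.memLp.coeFn_toLp] with x hx
  rw [hx]
  simp [mul_comm]

/-- The adjoint `A†` is the differential expression in the sense of distributions. -/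
theorem mem_graph_adjoint_iff {ν : ℝ} {V : ℝ → ℝ} (hV : ContinuousOn V (Ioi 0)) {u f : H} :
    (u, f) ∈ (A ν V).adjoint.graph ↔
      ∀ χ, IsTest χ → ∫ x, f x * χ x ∂halfLine = ∫ x, u x * expr ν V χ x ∂halfLine := by
  have hd := dense_domain_A ν hV
  constructor
  · intro h χ hχ
    obtain ⟨y, hy, hy'⟩ := (LinearPMap.mem_graph_iff _).1 h
    simp only at hy hy'
    obtain ⟨x, hx, hx'⟩ := (LinearPMap.mem_graph_iff _).1
      ((A_graph ν V).symm ▸ mem_minGraph_of_isTest hV hχ.star : _ ∈ (A ν V).graph)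
    have e := LinearPMap.adjoint_isFormalAdjoint hd y x
    simp only at hx hx'
    rw [hy, hy', hx, hx', inner_eq_integral_star, inner_eq_integral_star, star_inj] at e
    calc _ = _ := integral_congr_ae ?_
      _ = _ := e
      _ = _ := integral_congr_ae ?_
    · filter_upwards [hχ.star.memLp.coeFn_toLp] with x hx
      rw [hx, star_star]
    · filter_upwards [(hχ.star.memLp_expr (ν := ν) hV).coeFn_toLp] with x hx
      rw [hx, IsTest.expr_star, star_star]
  · intro h
    have key : ∀ x : (A ν V).domain, inner ℂ f (x : H) = inner ℂ u (A ν V x) := by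
      intro x
      have hx := (A ν V).mem_graph x
      rw [A_graph] at hx
      obtain ⟨χ, hχ, h1, h2⟩ := hx
      simp only at h1 h2
      rw [inner_eq_integral_star, inner_eq_integral_star, star_inj]
      calc _ = _ := integral_congr_ae ?_
        _ = _ := h _ hχ.star
        _ = _ := integral_congr_ae ?_
      · filter_upwards [h1] with x hx
        rw [hx]
      · filter_upwards [h2] with x hx
        rw [hx, IsTest.expr_star]
    have hmem := LinearPMap.mem_adjoint_domain_of_exists (T := A ν V) u ⟨f, key⟩
    exact (LinearPMap.mem_graph_iff _).2 ⟨⟨u, hmem⟩, rfl, LinearPMap.adjoint_apply_eq hd _ key⟩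

/-- Green's identity against a test function. -/
theorem integral_expr_mul_test {ν : ℝ} {V : ℝ → ℝ} (hV : ContinuousOn V (Ioi 0))
    {u u₁ u₂ χ : ℝ → ℂ} (h1 : ∀ x > 0, HasDerivAt u (u₁ x) x)
    (h2 : ∀ x > 0, HasDerivAt u₁ (u₂ x) x) (hc : ContinuousOn u₂ (Ioi 0)) (hχ : IsTest χ) :
    ∫ x, (-u₂ x + (((ν ^ 2 - 1 / 4) / x ^ 2 + V x : ℝ) : ℂ) * u x) * χ x ∂halfLine
      = ∫ x, u x * expr ν V χ x ∂halfLine := by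
  have hu : ContinuousOn u (Ioi 0) := fun x hx => (h1 x hx).continuousAt.continuousWithinAt
  have hu₁ : ContinuousOn u₁ (Ioi 0) := fun x hx => (h2 x hx).continuousAt.continuousWithinAt
  have hp := continuousOn_potential ν hV
  have hi0 : Integrable fun x => u x * deriv χ x - u₁ x * χ x :=
    (hχ.deriv.integrable_mul hu).sub (hχ.integrable_mul hu₁)
  have hi1 : Integrable fun x => u x * deriv (deriv χ) x - u₂ x * χ x :=
    (hχ.deriv.deriv.integrable_mul hu).sub (hχ.integrable_mul hc)
  have hd : ∀ x, HasDerivAt (fun x => u x * deriv χ x - u₁ x * χ x)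
      (u x * deriv (deriv χ) x - u₂ x * χ x) x := by
    intro x
    by_cases hx : x ∈ Ioi (0 : ℝ)
    · exact (((h1 x hx).mul (hχ.differentiable_deriv x).hasDerivAt).sub
        ((h2 x hx).mul (hχ.differentiable x).hasDerivAt)).congr_deriv (by ring)
    · rw [hχ.deriv.deriv.eq_zero hx, hχ.eq_zero hx, mul_zero, mul_zero, sub_zero]
      refine (hasDerivAt_const x (0 : ℂ)).congr_of_eventuallyEq ?_
      have hn : x ∉ tsupport χ := fun h => hx (hχ.2.2 h)
      filter_upwards [(isClosed_tsupport χ).isOpen_compl.mem_nhds hn] with y hy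
      have h3 : deriv χ y = 0 := by_contra fun h => hy (support_deriv_subset h)
      rw [image_eq_zero_of_notMem_tsupport hy, h3]
      simp
  have h0 : ∫ x, (u x * deriv (deriv χ) x - u₂ x * χ x) ∂halfLine = 0 := by
    rw [setIntegral_eq_integral_of_forall_compl_eq_zero]
    · exact integral_eq_zero_of_hasDerivAt_of_integrable hd hi1 hi0
    · intro x hx
      rw [hχ.deriv.deriv.eq_zero hx, hχ.eq_zero hx]
      simp
  have hi2 : Integrable (fun x => (-u₂ x + (((ν ^ 2 - 1 / 4) / x ^ 2 + V x : ℝ) : ℂ) * u x) * χ x)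
      halfLine := (hχ.integrable_mul (hc.neg.add (hp.mul hu))).restrict
  have hi3 : Integrable (fun x => u x * expr ν V χ x) halfLine := by
    refine Integrable.congr (((hχ.deriv.deriv.integrable_mul hu).neg.add
      (hχ.integrable_mul (hp.mul hu))).restrict) (.of_forall fun x => ?_)
    simp only [expr, Pi.add_apply, Pi.neg_apply, Pi.mul_apply]
    ring
  rw [← sub_eq_zero, ← integral_sub hi2 hi3, ← h0]
  refine integral_congr_ae (.of_forall fun x => ?_)
  simp only [expr]
  ring

/-- Twice continuously differentiable functions belong to the domain of `A†` as soon as they and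
their image are square integrable. -/
theorem mem_graph_adjoint_of_hasDerivAt {ν : ℝ} {V : ℝ → ℝ} (hV : ContinuousOn V (Ioi 0)) {u f : H}
    {v v₁ v₂ : ℝ → ℂ} (h1 : ∀ x > 0, HasDerivAt v (v₁ x) x) (h2 : ∀ x > 0, HasDerivAt v₁ (v₂ x) x)
    (hc : ContinuousOn v₂ (Ioi 0)) (hu : u =ᵐ[halfLine] v)
    (hf : ∀ᵐ x ∂halfLine, f x = -v₂ x + (((ν ^ 2 - 1 / 4) / x ^ 2 + V x : ℝ) : ℂ) * v x) :
    (u, f) ∈ (A ν V).adjoint.graph := by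
  rw [mem_graph_adjoint_iff hV]
  intro χ hχ
  calc _ = _ := integral_congr_ae ?_
    _ = _ := integral_expr_mul_test (ν := ν) hV h1 h2 hc hχ
    _ = _ := integral_congr_ae ?_
  · filter_upwards [hf] with x hx
    rw [hx]
  · filter_upwards [hu] with x hx
    rw [hx]

/-- Elements of the kernel of `A† - z` are classical solutions. -/
theorem exists_classical_of_mem_graph_adjoint {ν : ℝ} {V : ℝ → ℝ} (hV : ContinuousOn V (Ioi 0))
    {u : H} {z : ℂ} (h : (u, z • u) ∈ (A ν V).adjoint.graph) :
    ∃ ψ ψ₁ : ℝ → ℂ, u =ᵐ[halfLine] ψ ∧ ∀ x > 0, HasDerivAt ψ (ψ₁ x) x ∧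
      HasDerivAt ψ₁ (((((ν ^ 2 - 1 / 4) / x ^ 2 + V x : ℝ) : ℂ) - z) * ψ x) x := by
  rw [mem_graph_adjoint_iff hV] at h
  have hul := locallyIntegrableOn_of_memLp (Lp.memLp u)
  have hQ : ContinuousOn (fun x => (((ν ^ 2 - 1 / 4) / x ^ 2 + V x : ℝ) : ℂ) - z) (Ioi 0) :=
    (continuousOn_potential ν hV).sub continuousOn_const
  refine exists_hasDerivAt_of_weak hQ hul fun χ hχ => ?_
  have e := h _ hχ.isTest
  have hi1 := integrable_smul_of_isRealTest hul hχ.deriv.deriv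
  have hi2 := integrable_smul_of_isRealTest
    (hul.continuousOn_mul (continuousOn_potential ν hV) isOpen_Ioi.isLocallyClosed) hχ
  have hi3 : Integrable (fun x => z * χ x • u x) halfLine :=
    (integrable_smul_of_isRealTest hul hχ).const_mul z
  have hd : ∀ x, deriv (deriv fun x => (χ x : ℂ)) x = ((deriv (deriv χ) x : ℝ) : ℂ) := by
    have : (deriv fun x => (χ x : ℂ)) = fun x => ((deriv χ x : ℝ) : ℂ) :=
      funext fun x => (hχ.differentiable x).hasDerivAt.ofReal_comp.deriv
    intro x
    rw [this]
    exact (hχ.deriv.differentiable x).hasDerivAt.ofReal_comp.deriv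
  have e1 : ∫ x, (z • u : H) x * (χ x : ℂ) ∂halfLine = ∫ x, z * χ x • u x ∂halfLine := by
    refine integral_congr_ae ?_
    filter_upwards [Lp.coeFn_smul z u] with x hx
    rw [hx]
    simp only [Pi.smul_apply, smul_eq_mul, Complex.real_smul]
    ring
  have e2 : ∫ x, u x * expr ν V (fun x => (χ x : ℂ)) x ∂halfLine
      = (∫ x, χ x • ((((ν ^ 2 - 1 / 4) / x ^ 2 + V x : ℝ) : ℂ) * u x) ∂halfLine)
        - ∫ x, deriv (deriv χ) x • u x ∂halfLine := by
    rw [← integral_sub hi2 hi1]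
    refine integral_congr_ae (.of_forall fun x => ?_)
    simp only [expr, hd, Complex.real_smul]
    ring
  rw [e1, e2] at e
  rw [eq_sub_iff_add_eq, add_comm, ← eq_sub_iff_add_eq] at e
  rw [e, ← integral_sub hi2 hi3]
  refine integral_congr_ae (.of_forall fun x => ?_)
  simp only [Complex.real_smul]
  ring

/-! ### Boundary expansions -/

theorem IsRemainder.sub {f g : ℝ → ℂ} (hf : IsRemainder f) (hg : IsRemainder g) :
    IsRemainder fun x => f x - g x :=
  IsBigO.sub hf hg

theorem IsRemainder.const_mul {f : ℝ → ℂ} (hf : IsRemainder f) (c : ℂ) :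
    IsRemainder fun x => c * f x :=
  IsBigO.const_mul_left hf c

theorem IsRemainder.congr {f g : ℝ → ℂ} (hf : IsRemainder f) (h : f =ᶠ[𝓝[>] 0] g) :
    IsRemainder g :=
  IsBigO.congr' hf h .rfl

/-- A remainder estimate for one representative holds for the continuous representative. -/
theorem IsRemainder.of_ae_eq {f g : ℝ → ℂ} (hf : IsRemainder f) (h : f =ᵐ[halfLine] g)
    (hg : ContinuousOn g (Ioi 0)) : IsRemainder g := by
  obtain ⟨C, hC⟩ := hf.bound
  obtain ⟨δ, hδ, hδ'⟩ := mem_nhdsGT_iff_exists_Ioo_subset.1 hC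
  refine IsBigO.of_bound C (mem_nhdsGT_iff_exists_Ioo_subset.2 ⟨δ, hδ, fun x hx => ?_⟩)
  have hsub : Ioo 0 δ ⊆ Ioi (0 : ℝ) := fun y hy => hy.1
  have hB : Continuous fun y : ℝ => C * ‖y ^ (3 / 2 : ℝ)‖ :=
    continuous_const.mul (continuous_id.rpow_const fun x => Or.inr (by positivity)).norm
  -- the continuous function `max (‖g‖ - C x^{3/2}) 0` vanishes almost everywhere on `(0, δ)`
  have hE := Measure.eqOn_open_of_ae_eq (μ := volume) (U := Ioo 0 δ)
    (f := fun y => max (‖g y‖ - C * ‖y ^ (3 / 2 : ℝ)‖) 0) (g := fun _ => 0) ?_ isOpen_Ioo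
    (((hg.mono hsub).norm.sub hB.continuousOn).sup continuousOn_const) continuousOn_const
  · have := hE hx
    simp only [max_eq_right_iff, sub_nonpos] at this
    exact this
  · have h' := ae_mono (Measure.restrict_mono hsub le_rfl) h
    filter_upwards [h', ae_restrict_mem measurableSet_Ioo] with y hy hy'
    rw [← hy, max_eq_right_iff, sub_nonpos]
    exact hδ' hy'

/-- `α x^{1/2 - ν} + β x^{1/2 + ν}` is the boundary expansion at `0` of the class `u`. -/
def HasExpansion (ν : ℝ) (u : H) (α β : ℂ) : Prop :=
  ∃ v : ℝ → ℂ, u =ᵐ[halfLine] v ∧ IsRemainder fun x => v x - (α * bMinus ν x + β * bPlus ν x)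

theorem HasExpansion.sub {ν : ℝ} {u v : H} {α β γ δ : ℂ} (hu : HasExpansion ν u α β)
    (hv : HasExpansion ν v γ δ) : HasExpansion ν (u - v) (α - γ) (β - δ) := by
  obtain ⟨f, hf, hf'⟩ := hu
  obtain ⟨g, hg, hg'⟩ := hv
  exact ⟨f - g, (Lp.coeFn_sub u v).trans (hf.sub hg),
    (hf'.sub hg').congr (.of_forall fun x => by simp only [Pi.sub_apply]; ring)⟩

theorem HasExpansion.smul {ν : ℝ} {u : H} {α β : ℂ} (c : ℂ) (hu : HasExpansion ν u α β) :
    HasExpansion ν (c • u) (c * α) (c * β) := by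
  obtain ⟨f, hf, hf'⟩ := hu
  exact ⟨c • f, (Lp.coeFn_smul c u).trans (hf.const_smul c),
    (hf'.const_mul c).congr (.of_forall fun x => by simp only [Pi.smul_apply, smul_eq_mul]; ring)⟩

theorem hasBoundaryCoeff_bMinus_add_iff {ν : ℝ} {θ c : ℂ} {u : H} :
    HasBoundaryCoeff (fun x => bMinus ν x + θ * bPlus ν x) u c ↔ HasExpansion ν u c (c * θ) := by
  simp only [HasBoundaryCoeff, HasExpansion, mul_add, mul_assoc]

theorem hasBoundaryCoeff_bMinus_iff {ν : ℝ} {c : ℂ} {u : H} :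
    HasBoundaryCoeff (bMinus ν) u c ↔ HasExpansion ν u c 0 := by
  simp only [HasBoundaryCoeff, HasExpansion, zero_mul, add_zero]

theorem hasBoundaryCoeff_bPlus_iff {ν : ℝ} {c : ℂ} {u : H} :
    HasBoundaryCoeff (bPlus ν) u c ↔ HasExpansion ν u 0 c := by
  simp only [HasBoundaryCoeff, HasExpansion, zero_mul, zero_add]

theorem mem_boundarySpace_theta_iff {ν : ℝ} {θ : ℂ} {u : H} :
    u ∈ boundarySpace (fun x => bMinus ν x + θ * bPlus ν x) ↔
      ∃ c, HasExpansion ν u c (c * θ) := by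
  simp only [← hasBoundaryCoeff_bMinus_add_iff]
  rfl

theorem mem_boundarySpace_bPlus_iff {ν : ℝ} {u : H} :
    u ∈ boundarySpace (bPlus ν) ↔ ∃ c, HasExpansion ν u 0 c := by
  simp only [← hasBoundaryCoeff_bPlus_iff]
  rfl

theorem tendsto_rpow_nhdsGT_zero {s : ℝ} (hs : 0 < s) :
    Tendsto (fun x : ℝ => x ^ s) (𝓝[>] 0) (𝓝 0) := by
  have := (Real.continuousAt_rpow_const 0 s (Or.inr hs.le)).tendsto
  rw [Real.zero_rpow hs.ne'] at this
  exact this.mono_left nhdsWithin_le_nhds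

theorem tendsto_ofReal_rpow_nhdsGT_zero {s : ℝ} (hs : 0 < s) :
    Tendsto (fun x : ℝ => ((x ^ s : ℝ) : ℂ)) (𝓝[>] 0) (𝓝 0) := by
  have := (Complex.continuous_ofReal.tendsto 0).comp (tendsto_rpow_nhdsGT_zero hs)
  rwa [Complex.ofReal_zero] at this

theorem IsRemainder.tendsto_rpow_mul {f : ℝ → ℂ} (hf : IsRemainder f) {s : ℝ} (hs : s < 3 / 2) :
    Tendsto (fun x : ℝ => ((x ^ (-s) : ℝ) : ℂ) * f x) (𝓝[>] 0) (𝓝 0) := by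
  have h1 := (Complex.isBigO_ofReal_left.2 (isBigO_refl (fun x : ℝ => x ^ (-s)) (𝓝[>] 0))).mul hf
  refine h1.trans_tendsto ((tendsto_rpow_nhdsGT_zero (sub_pos.2 hs)).congr' ?_)
  filter_upwards [self_mem_nhdsWithin] with x hx
  rw [← Real.rpow_add hx]
  congr 1
  ring

theorem ofReal_rpow_mul_ofReal_rpow {x : ℝ} (hx : 0 < x) (s t : ℝ) :
    ((x ^ s : ℝ) : ℂ) * ((x ^ t : ℝ) : ℂ) = ((x ^ (s + t) : ℝ) : ℂ) := by
  rw [← Complex.ofReal_mul, ← Real.rpow_add hx]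

/-- The coefficient of the dominant term is a limit. -/
theorem IsRemainder.tendsto_bMinus {ν : ℝ} (hν : 0 < ν) {f : ℝ → ℂ} {α β : ℂ}
    (hf : IsRemainder fun x => f x - (α * bMinus ν x + β * bPlus ν x)) :
    Tendsto (fun x : ℝ => ((x ^ (-(1 / 2 - ν)) : ℝ) : ℂ) * f x) (𝓝[>] 0) (𝓝 α) := by
  have h1 := hf.tendsto_rpow_mul (s := 1 / 2 - ν) (by linarith)
  have h2 : Tendsto (fun x : ℝ => ((x ^ (2 * ν) : ℝ) : ℂ)) (𝓝[>] 0) (𝓝 0) :=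
    tendsto_ofReal_rpow_nhdsGT_zero (by positivity)
  have h3 := h1.add ((h2.const_mul β).const_add α)
  simp only [mul_zero, add_zero, zero_add] at h3
  refine h3.congr' ?_
  filter_upwards [self_mem_nhdsWithin] with x hx
  have e1 := ofReal_rpow_mul_ofReal_rpow hx (-(1 / 2 - ν)) (1 / 2 - ν)
  have e2 := ofReal_rpow_mul_ofReal_rpow hx (-(1 / 2 - ν)) (1 / 2 + ν)
  rw [neg_add_cancel, Real.rpow_zero, Complex.ofReal_one] at e1
  rw [show -(1 / 2 - ν) + (1 / 2 + ν) = 2 * ν by ring] at e2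
  rw [← e2, bMinus, bPlus]
  linear_combination (-α) * e1

/-- The coefficient of the subdominant term is a limit if the dominant term is absent. -/
theorem IsRemainder.tendsto_bPlus {ν : ℝ} (hν : ν < 1) {f : ℝ → ℂ} {β : ℂ}
    (hf : IsRemainder fun x => f x - β * bPlus ν x) :
    Tendsto (fun x : ℝ => ((x ^ (-(1 / 2 + ν)) : ℝ) : ℂ) * f x) (𝓝[>] 0) (𝓝 β) := by
  have h1 := (hf.tendsto_rpow_mul (s := 1 / 2 + ν) (by linarith)).add_const β
  rw [zero_add] at h1
  refine h1.congr' ?_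
  filter_upwards [self_mem_nhdsWithin] with x hx
  have e1 := ofReal_rpow_mul_ofReal_rpow hx (-(1 / 2 + ν)) (1 / 2 + ν)
  rw [neg_add_cancel, Real.rpow_zero, Complex.ofReal_one] at e1
  rw [bPlus]
  linear_combination (-β) * e1

theorem continuousOn_ofReal_rpow (s : ℝ) :
    ContinuousOn (fun x : ℝ => ((x ^ s : ℝ) : ℂ)) (Ioi 0) := fun _ hx =>
  (hasDerivAt_ofReal_rpow s hx).continuousAt.continuousWithinAt

theorem continuousOn_expansion (ν : ℝ) (α β : ℂ) :
    ContinuousOn (fun x => α * bMinus ν x + β * bPlus ν x) (Ioi 0) :=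
  (continuousOn_const.mul (continuousOn_ofReal_rpow _)).add
    (continuousOn_const.mul (continuousOn_ofReal_rpow _))

/-- The expansion holds pointwise for a continuous representative. -/
theorem HasExpansion.isRemainder {ν : ℝ} {u : H} {α β : ℂ} (h : HasExpansion ν u α β) {v : ℝ → ℂ}
    (hv : u =ᵐ[halfLine] v) (hc : ContinuousOn v (Ioi 0)) :
    IsRemainder fun x => v x - (α * bMinus ν x + β * bPlus ν x) := by
  obtain ⟨w, hw, hw'⟩ := h
  exact hw'.of_ae_eq ((hw.symm.trans hv).sub .rfl) (hc.sub (continuousOn_expansion ν α β))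

theorem HasExpansion.eq_zero {ν : ℝ} (hν0 : 0 < ν) (hν1 : ν < 1) {α β : ℂ}
    (h : HasExpansion ν 0 α β) : α = 0 ∧ β = 0 := by
  have h' := h.isRemainder (Lp.coeFn_zero ℂ 2 halfLine) continuousOn_const
  simp only [Pi.zero_apply] at h'
  have hα : α = 0 :=
    tendsto_nhds_unique (IsRemainder.tendsto_bMinus hν0 (f := fun _ => 0) h') (by simp)
  subst hα
  simp only [zero_mul, zero_add] at h'
  have h2 := IsRemainder.tendsto_bPlus hν1 (f := fun _ => 0) h'
  exact ⟨rfl, tendsto_nhds_unique h2 (by simp)⟩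

/-! ### Elements of the domain of the adjoint with prescribed expansion -/

theorem memLp_rpow_mul {s : ℝ} (hs : -(1 / 2) < s) {c : ℝ → ℂ} (hc : ContinuousOn c (Ici 0))
    (h0 : ∀ x, 2 < x → c x = 0) : MemLp (fun x => ((x ^ s : ℝ) : ℂ) * c x) 2 halfLine := by
  obtain ⟨M, hM⟩ := (isCompact_Icc (a := (0 : ℝ)) (b := 2)).exists_bound_of_continuousOn
    (hc.mono Icc_subset_Ici_self)
  have hm : AEStronglyMeasurable (fun x => ((x ^ s : ℝ) : ℂ) * c x) halfLine :=
    ((continuousOn_ofReal_rpow s).mul (hc.mono Ioi_subset_Ici_self)).aestronglyMeasurable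
      measurableSet_Ioi
  rw [memLp_two_iff_integrable_sq_norm hm]
  have hi : IntegrableOn (fun x : ℝ => M ^ 2 * x ^ (2 * s)) (Ioc 0 2) := by
    rw [← intervalIntegrable_iff_integrableOn_Ioc_of_le zero_le_two]
    exact (intervalIntegral.intervalIntegrable_rpow' (by linarith)).const_mul _
  have hi' : IntegrableOn (fun x => ‖((x ^ s : ℝ) : ℂ) * c x‖ ^ 2) (Ioc 0 2) := by
    refine Integrable.mono' hi
      ((hm.mono_measure (Measure.restrict_mono Ioc_subset_Ioi_self le_rfl)).norm.pow 2) ?_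
    filter_upwards [ae_restrict_mem measurableSet_Ioc] with x hx
    have h1 := hM x ⟨hx.1.le, hx.2⟩
    rw [norm_pow, norm_norm, norm_mul, mul_pow, Complex.norm_real,
      Real.norm_of_nonneg (Real.rpow_nonneg hx.1.le _), ← Real.rpow_natCast (x ^ s),
      ← Real.rpow_mul hx.1.le, mul_comm]
    norm_num only [Nat.cast_ofNat]
    rw [mul_comm s 2]
    gcongr
    exact Real.rpow_nonneg hx.1.le _
  refine hi'.of_forall_sdiff_eq_zero measurableSet_Ioi fun x hx => ?_
  have hx2 : 2 < x := lt_of_not_ge fun h => hx.2 ⟨hx.1, h⟩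
  simp [h0 x hx2]

theorem exists_cutoff : ∃ η : ℝ → ℝ, ContDiff ℝ ∞ η ∧ (∀ x < 1, η x = 1) ∧ ∀ x > 2, η x = 0 :=
  ⟨fun x => Real.smoothTransition (2 - x),
    Real.smoothTransition.contDiff.comp (contDiff_const.sub contDiff_id),
    fun x hx => Real.smoothTransition.one_of_one_le (by linarith),
    fun x hx => Real.smoothTransition.zero_of_nonpos (by linarith)⟩

/-- The powers `x^s` with `s (s - 1) = ν² - 1/4`, cut off at infinity, are in the domain of
`A†`. -/
theorem exists_mem_graph_adjoint_rpow {ν : ℝ} {V : ℝ → ℝ} (hV : ContinuousOn V (Ici 0)) {s : ℝ}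
    (hs : -(1 / 2) < s) (hs' : s * (s - 1) = ν ^ 2 - 1 / 4) :
    ∃ u f : H, (u, f) ∈ (A ν V).adjoint.graph ∧
      ∃ v : ℝ → ℂ, u =ᵐ[halfLine] v ∧ ∀ x < 1, v x = ((x ^ s : ℝ) : ℂ) := by
  obtain ⟨η, hη, h1, h2⟩ := exists_cutoff
  have hη1 : ContDiff ℝ ∞ (deriv η) := (contDiff_infty_iff_deriv.1 hη).2
  have hη2 : ContDiff ℝ ∞ (deriv (deriv η)) := (contDiff_infty_iff_deriv.1 hη1).2
  have hd0 : ∀ x, HasDerivAt (fun x => (η x : ℂ)) (deriv η x : ℝ) x := fun x =>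
    (hη.differentiable (by simp) x).hasDerivAt.ofReal_comp
  have hd1 : ∀ x, HasDerivAt (fun x => ((deriv η x : ℝ) : ℂ)) (deriv (deriv η) x : ℝ) x := fun x =>
    (hη1.differentiable (by simp) x).hasDerivAt.ofReal_comp
  have hlow : ∀ x < 1, deriv η x = 0 := fun x hx => by
    have : η =ᶠ[𝓝 x] fun _ => 1 := by
      filter_upwards [Iio_mem_nhds hx] with y hy using h1 y hy
    simp [this.deriv_eq]
  have hhigh : ∀ x > 2, deriv η x = 0 := fun x hx => by
    have : η =ᶠ[𝓝 x] fun _ => 0 := by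
      filter_upwards [Ioi_mem_nhds hx] with y hy using h2 y hy
    simp [this.deriv_eq]
  have hhigh2 : ∀ x > 2, deriv (deriv η) x = 0 := fun x hx => by
    have : deriv η =ᶠ[𝓝 x] fun _ => 0 := by
      filter_upwards [Ioi_mem_nhds hx] with y hy using hhigh y hy
    simp [this.deriv_eq]
  -- `x⁻¹ η'` is written with `(max x (1/2))⁻¹`, which is continuous, since `η' = 0` on `(0, 1)`
  set c : ℝ → ℂ := fun x =>
    ((V x * η x - deriv (deriv η) x - 2 * s * (max x (1 / 2))⁻¹ * deriv η x : ℝ) : ℂ) with hc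
  have hcc : ContinuousOn c (Ici 0) := by
    refine Complex.continuous_ofReal.comp_continuousOn ?_
    have hmax : Continuous fun x : ℝ => (max x (1 / 2))⁻¹ :=
      (continuous_id.max continuous_const).inv₀ fun x => (lt_max_of_lt_right (by norm_num)).ne'
    exact ((hV.mul hη.continuous.continuousOn).sub hη2.continuous.continuousOn).sub
      ((continuous_const.mul hmax).mul hη1.continuous).continuousOn
  have hmem := memLp_rpow_mul hs (c := fun x => (η x : ℂ))
    (Complex.continuous_ofReal.comp hη.continuous).continuousOn (fun x hx => by simp [h2 x hx])
  have hmem' := memLp_rpow_mul hs hcc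
    (fun x hx => by simp [hc, h2 x hx, hhigh x hx, hhigh2 x hx])
  refine ⟨hmem.toLp _, hmem'.toLp _, ?_, _, hmem.coeFn_toLp, fun x hx => by simp [h1 x hx]⟩
  refine mem_graph_adjoint_of_hasDerivAt (hV.mono Ioi_subset_Ici_self)
    (v₁ := fun x => ((s * x ^ (s - 1) : ℝ) : ℂ) * (η x : ℂ) + ((x ^ s : ℝ) : ℂ) * (deriv η x : ℝ))
    (v₂ := fun x => ((s * ((s - 1) * x ^ (s - 1 - 1)) : ℝ) : ℂ) * (η x : ℂ)
      + ((s * x ^ (s - 1) : ℝ) : ℂ) * (deriv η x : ℝ)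
      + (((s * x ^ (s - 1) : ℝ) : ℂ) * (deriv η x : ℝ)
      + ((x ^ s : ℝ) : ℂ) * (deriv (deriv η) x : ℝ)))
    (fun x hx => (hasDerivAt_ofReal_rpow s hx).mul (hd0 x))
    (fun x hx => ?_) ?_ hmem.coeFn_toLp ?_
  · have := (hasDerivAt_ofReal_rpow (s - 1) hx).const_mul (s : ℂ)
    simp only [← Complex.ofReal_mul] at this
    exact (this.mul (hd0 x)).add ((hasDerivAt_ofReal_rpow s hx).mul (hd1 x))
  · have e : ∀ t : ℝ, ContinuousOn (fun x : ℝ => x ^ t) (Ioi 0) := fun t =>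
      continuousOn_id.rpow_const fun x hx => Or.inl (ne_of_gt hx)
    have e0 := e s
    have e1 := e (s - 1)
    have e2 := e (s - 1 - 1)
    have := hη.continuous
    have := hη1.continuous
    have := hη2.continuous
    fun_prop
  · filter_upwards [hmem'.coeFn_toLp, ae_restrict_mem measurableSet_Ioi] with x hx hx0
    have hx0 : 0 < x := hx0
    have hmx : (max x (1 / 2))⁻¹ * deriv η x = x⁻¹ * deriv η x := by
      rcases lt_or_ge x 1 with h | h
      · simp [hlow x h]
      · rw [max_eq_left (by linarith)]
    rw [hx, hc]
    simp only [mul_assoc, hmx, Pi.mul_apply]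
    rw [← hs', Real.rpow_sub_one hx0.ne' (s - 1), Real.rpow_sub_one hx0.ne' s]
    have hx' : (x : ℂ) ≠ 0 := by exact_mod_cast hx0.ne'
    push_cast
    field_simp
    ring

theorem exists_mem_graph_adjoint_bMinus {ν : ℝ} (hν : ν < 1) {V : ℝ → ℝ}
    (hV : ContinuousOn V (Ici 0)) :
    ∃ u f : H, (u, f) ∈ (A ν V).adjoint.graph ∧ HasExpansion ν u 1 0 := by
  obtain ⟨u, f, h, v, hv, hv'⟩ := exists_mem_graph_adjoint_rpow (ν := ν) hV (s := 1 / 2 - ν)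
    (by linarith) (by ring)
  refine ⟨u, f, h, v, hv, (isBigO_zero _ _).congr' ?_ .rfl⟩
  filter_upwards [mem_nhdsWithin_of_mem_nhds (Iio_mem_nhds one_pos)] with x hx
  simp [hv' x hx, bMinus]

theorem exists_mem_graph_adjoint_bPlus {ν : ℝ} (hν : 0 < ν) {V : ℝ → ℝ}
    (hV : ContinuousOn V (Ici 0)) :
    ∃ u f : H, (u, f) ∈ (A ν V).adjoint.graph ∧ HasExpansion ν u 0 1 := by
  obtain ⟨u, f, h, v, hv, hv'⟩ := exists_mem_graph_adjoint_rpow (ν := ν) hV (s := 1 / 2 + ν)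
    (by linarith) (by ring)
  refine ⟨u, f, h, v, hv, (isBigO_zero _ _).congr' ?_ .rfl⟩
  filter_upwards [mem_nhdsWithin_of_mem_nhds (Iio_mem_nhds one_pos)] with x hx
  simp [hv' x hx, bPlus]

/-! ### The Wronskian -/

/-- The Wronskian of two solutions is constant. -/
theorem wronskian_eq_const {Q φ φ₁ ψ ψ₁ : ℝ → ℂ} (hφ : ∀ x > 0, HasDerivAt φ (φ₁ x) x)
    (hφ₁ : ∀ x > 0, HasDerivAt φ₁ (Q x * φ x) x) (hψ : ∀ x > 0, HasDerivAt ψ (ψ₁ x) x)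
    (hψ₁ : ∀ x > 0, HasDerivAt ψ₁ (Q x * ψ x) x) :
    ∃ w : ℂ, ∀ x > 0, φ₁ x * ψ x - φ x * ψ₁ x = w := by
  have hd : ∀ x > 0, HasDerivAt (fun x => φ₁ x * ψ x - φ x * ψ₁ x) 0 x := fun x hx =>
    (((hφ₁ x hx).mul (hψ x hx)).sub ((hφ x hx).mul (hψ₁ x hx))).congr_deriv (by ring)
  refine ⟨φ₁ 1 * ψ 1 - φ 1 * ψ₁ 1, fun x hx => ?_⟩
  exact isOpen_Ioi.is_const_of_deriv_eq_zero isPreconnected_Ioi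
    (fun y hy => (hd y hy).differentiableAt.differentiableWithinAt)
    (fun y hy => (hd y hy).deriv) hx (mem_Ioi.2 one_pos)

/-- If `φ ~ x^{1/2 + ν}` and `ψ ~ x^{1/2 - ν}`, then their Wronskian is `2ν`. No information on
the derivatives at the endpoint is needed: `(φ / ψ)' = w / ψ² ~ w x^{2ν - 1}`, and integration
gives `φ / ψ ~ w x^{2ν} / (2ν)`. -/
theorem wronskian_eq_two_mul {ν : ℝ} (hν : 0 < ν) {φ φ₁ ψ ψ₁ : ℝ → ℂ} {w : ℂ}
    (hφ : ∀ x > 0, HasDerivAt φ (φ₁ x) x) (hψ : ∀ x > 0, HasDerivAt ψ (ψ₁ x) x)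
    (hw : ∀ x > 0, φ₁ x * ψ x - φ x * ψ₁ x = w)
    (hφ0 : Tendsto (fun x : ℝ => ((x ^ (-(1 / 2 + ν)) : ℝ) : ℂ) * φ x) (𝓝[>] 0) (𝓝 1))
    (hψ0 : Tendsto (fun x : ℝ => ((x ^ (-(1 / 2 - ν)) : ℝ) : ℂ) * ψ x) (𝓝[>] 0) (𝓝 1)) :
    w = 2 * ν := by
  have hν' : (ν : ℂ) ≠ 0 := by exact_mod_cast hν.ne'
  set h : ℝ → ℂ := fun x => φ x / ψ x - w / (2 * ν) * ((x ^ (2 * ν) : ℝ) : ℂ) with hh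
  -- `h` is the error in `φ / ψ ~ w x^{2ν} / (2ν)`; the limit of `x^{-2ν} h` is known from the
  -- asymptotics of `φ` and `ψ`, and the bound on `h'` shows that it is zero
  have hquot : Tendsto (fun x : ℝ => ((x ^ (-(2 * ν)) : ℝ) : ℂ) * h x) (𝓝[>] 0)
      (𝓝 (1 - w / (2 * ν))) := by
    have := (hφ0.div hψ0 one_ne_zero).sub_const (w / (2 * ν))
    rw [div_one] at this
    refine this.congr' ?_
    filter_upwards [self_mem_nhdsWithin] with x hx
    have hx : 0 < x := hx
    have e1 := ofReal_rpow_mul_ofReal_rpow hx (-(2 * ν)) (2 * ν)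
    rw [neg_add_cancel, Real.rpow_zero, Complex.ofReal_one] at e1
    have e2 := ofReal_rpow_mul_ofReal_rpow hx (-(2 * ν)) (-(1 / 2 - ν))
    rw [show -(2 * ν) + -(1 / 2 - ν) = -(1 / 2 + ν) by ring] at e2
    have e3 : ((x ^ (-(1 / 2 - ν)) : ℝ) : ℂ) ≠ 0 := by
      exact_mod_cast (Real.rpow_pos_of_pos hx _).ne'
    simp only [Pi.div_apply, hh]
    rw [← e2, mul_assoc, mul_div_assoc, mul_div_mul_left _ _ e3]
    linear_combination (w / (2 * ν)) * e1
  have hh0 : Tendsto h (𝓝[>] 0) (𝓝 0) := by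
    have h2 : Tendsto (fun x : ℝ => ((x ^ (2 * ν) : ℝ) : ℂ)) (𝓝[>] 0) (𝓝 0) :=
      tendsto_ofReal_rpow_nhdsGT_zero (by positivity)
    have := h2.mul hquot
    rw [zero_mul] at this
    refine this.congr' ?_
    filter_upwards [self_mem_nhdsWithin] with x hx
    have e1 := ofReal_rpow_mul_ofReal_rpow hx (2 * ν) (-(2 * ν))
    rw [add_neg_cancel, Real.rpow_zero, Complex.ofReal_one] at e1
    rw [← mul_assoc, e1, one_mul]
  have hsq : Tendsto (fun x : ℝ => w * ((((x ^ (-(1 / 2 - ν)) : ℝ) : ℂ) * ψ x) ^ 2)⁻¹ - w)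
      (𝓝[>] 0) (𝓝 0) := by
    have := (((hψ0.pow 2).inv₀ (by simp)).const_mul w).sub_const w
    simpa using this
  have hmain : ∀ ε > 0, ‖1 - w / (2 * ν)‖ ≤ ε := by
    intro ε hε
    have hev : ∀ᶠ x : ℝ in 𝓝[>] 0,
        ‖w * ((((x ^ (-(1 / 2 - ν)) : ℝ) : ℂ) * ψ x) ^ 2)⁻¹ - w‖ ≤ ε * (2 * ν) := by
      have := hsq.norm
      rw [norm_zero] at this
      exact (this.eventually (gt_mem_nhds (show 0 < ε * (2 * ν) by positivity))).mono
        fun _ => le_of_lt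
    have hev2 : ∀ᶠ x : ℝ in 𝓝[>] 0, ((x ^ (-(1 / 2 - ν)) : ℝ) : ℂ) * ψ x ≠ 0 :=
      hψ0.eventually_ne one_ne_zero
    obtain ⟨δ, hδ, hδ'⟩ := mem_nhdsGT_iff_exists_Ioo_subset.1 (hev.and hev2)
    have hder : ∀ x ∈ Ioo 0 δ, HasDerivAt h (w / ψ x ^ 2 - w * ((x ^ (2 * ν - 1) : ℝ) : ℂ)) x := by
      intro x hx
      have hne : ψ x ≠ 0 := right_ne_zero_of_mul (hδ' hx).2
      refine (((hφ x hx.1).div (hψ x hx.1) hne).sub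
        ((hasDerivAt_ofReal_rpow (2 * ν) hx.1).const_mul (w / (2 * ν)))).congr_deriv ?_
      rw [hw x hx.1]
      push_cast
      field_simp
    have hbd : ∀ x ∈ Ioo 0 δ, ‖w / ψ x ^ 2 - w * ((x ^ (2 * ν - 1) : ℝ) : ℂ)‖
        ≤ ε * (2 * ν * x ^ (2 * ν - 1)) := by
      intro x hx
      have hne : ψ x ≠ 0 := right_ne_zero_of_mul (hδ' hx).2
      have e1 : ((x ^ (-(1 / 2 - ν)) : ℝ) : ℂ) ^ 2 = ((x ^ (2 * ν - 1) : ℝ) : ℂ) := by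
        rw [sq, ofReal_rpow_mul_ofReal_rpow hx.1]
        congr 2
        ring
      have e2 : ((x ^ (2 * ν - 1) : ℝ) : ℂ) ≠ 0 := by
        exact_mod_cast (Real.rpow_pos_of_pos hx.1 _).ne'
      have e3 : w / ψ x ^ 2 - w * ((x ^ (2 * ν - 1) : ℝ) : ℂ) = ((x ^ (2 * ν - 1) : ℝ) : ℂ) *
          (w * ((((x ^ (-(1 / 2 - ν)) : ℝ) : ℂ) * ψ x) ^ 2)⁻¹ - w) := by
        rw [mul_pow, e1]
        field_simp
      rw [e3, norm_mul, Complex.norm_real, Real.norm_of_nonneg (Real.rpow_nonneg hx.1.le _)]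
      calc _ ≤ x ^ (2 * ν - 1) * (ε * (2 * ν)) :=
            mul_le_mul_of_nonneg_left (hδ' hx).1 (Real.rpow_nonneg hx.1.le _)
        _ = _ := by ring
    have hx_le : ∀ x ∈ Ioo 0 δ, ‖h x‖ ≤ ε * x ^ (2 * ν) := by
      intro x hx
      have hs : ∀ s ∈ Ioo 0 x, ‖h x‖ ≤ ‖h s‖ + ε * (x ^ (2 * ν) - s ^ (2 * ν)) := by
        intro s hs
        have hsub : ∀ y ∈ Icc s x, y ∈ Ioo 0 δ := fun y hy =>
          ⟨hs.1.trans_le hy.1, hy.2.trans_lt hx.2⟩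
        exact image_norm_le_of_norm_deriv_right_le_deriv_boundary' (f := h) (a := s) (b := x)
          (B := fun y => ‖h s‖ + ε * (y ^ (2 * ν) - s ^ (2 * ν)))
          (B' := fun y => ε * (2 * ν * y ^ (2 * ν - 1)))
          (fun y hy => (hder y (hsub y hy)).continuousAt.continuousWithinAt)
          (fun y hy => (hder y (hsub y ⟨hy.1, hy.2.le⟩)).hasDerivWithinAt) (by simp)
          (((continuous_id.rpow_const fun x => Or.inr (by positivity)).sub
            continuous_const).const_mul ε |>.const_add _ |>.continuousOn)
          (fun y hy => ((((Real.hasDerivAt_rpow_const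
            (Or.inl (hsub y ⟨hy.1, hy.2.le⟩).1.ne')).sub_const _).const_mul ε).const_add
              _).hasDerivWithinAt)
          (fun y hy => hbd y (hsub y ⟨hy.1, hy.2.le⟩)) (right_mem_Icc.2 hs.2.le)
      have hlim : Tendsto (fun s : ℝ => ‖h s‖ + ε * (x ^ (2 * ν) - s ^ (2 * ν))) (𝓝[>] 0)
          (𝓝 (ε * x ^ (2 * ν))) := by
        have := hh0.norm.add (((tendsto_rpow_nhdsGT_zero
          (show 0 < 2 * ν by positivity)).const_sub (x ^ (2 * ν))).const_mul ε)
        simpa using this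
      exact ge_of_tendsto hlim (mem_nhdsGT_iff_exists_Ioo_subset.2 ⟨x, hx.1, hs⟩)
    refine le_of_tendsto hquot.norm (mem_nhdsGT_iff_exists_Ioo_subset.2 ⟨δ, hδ, fun x hx => ?_⟩)
    have e1 : x ^ (-(2 * ν)) * x ^ (2 * ν) = 1 := by
      rw [← Real.rpow_add hx.1, neg_add_cancel, Real.rpow_zero]
    have hp : 0 ≤ x ^ (-(2 * ν)) := Real.rpow_nonneg hx.1.le _
    change ‖_‖ ≤ ε
    rw [norm_mul, Complex.norm_real, Real.norm_of_nonneg hp]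
    calc _ ≤ x ^ (-(2 * ν)) * (ε * x ^ (2 * ν)) := mul_le_mul_of_nonneg_left (hx_le x hx) hp
      _ = ε := by linear_combination ε * e1
  have h0 : 1 - w / (2 * ν) = 0 := by
    rw [← norm_eq_zero]
    exact le_antisymm (le_of_forall_pos_le_add fun ε hε => by simpa using hmain ε hε)
      (norm_nonneg _)
  rw [sub_eq_zero, eq_div_iff (by simpa using hν'), one_mul] at h0
  exact h0.symm

/-! ### Resolvents of restrictions -/

theorem IsResolvent.mem_graph {B : H →ₗ.[ℂ] H} {S : Submodule ℂ H} {z : ℂ} {R : H →L[ℂ] H}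
    (h : IsResolvent (B.domRestrict S) z R) (f : H) : R f ∈ S ∧ (R f, f + z • R f) ∈ B.graph := by
  obtain ⟨hm, he⟩ := h.1 f
  refine ⟨hm.1, (LinearPMap.mem_graph_iff _).2 ⟨⟨R f, hm.2⟩, rfl, ?_⟩⟩
  have e : B.domRestrict S ⟨R f, hm⟩ = B ⟨R f, hm.2⟩ := LinearPMap.domRestrict_apply rfl
  exact e ▸ sub_eq_iff_eq_add.1 he

theorem IsResolvent.eq_of_mem_graph {B : H →ₗ.[ℂ] H} {S : Submodule ℂ H} {z : ℂ} {R : H →L[ℂ] H}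
    (h : IsResolvent (B.domRestrict S) z R) {u f : H} (hu : u ∈ S)
    (hg : (u, f + z • u) ∈ B.graph) : R f = u := by
  obtain ⟨y, hy, hy'⟩ := (LinearPMap.mem_graph_iff _).1 hg
  simp only at hy hy'
  subst hy
  have := h.2 ⟨y, hu, y.2⟩
  have e : B.domRestrict S ⟨y, hu, y.2⟩ = B y := LinearPMap.domRestrict_apply rfl
  rw [e, hy'] at this
  simpa using this

/-! ### The Green kernel -/

/-- The kernel `φ(min x y) ψ(max x y) / (2ν)`, where `φ` is the regular solution and `ψ` the square
integrable one, with Wronskian `2ν`. -/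
def greenKernel (ν : ℝ) (φ ψ : ℝ → ℂ) (x y : ℝ) : ℂ := φ (min x y) * ψ (max x y) / (2 * ν)

theorem continuousOn_greenKernel (ν : ℝ) {φ ψ : ℝ → ℂ} (hφ : Continuous φ)
    (hψ : ContinuousOn ψ (Ioi 0)) :
    ContinuousOn (fun p : ℝ × ℝ => greenKernel ν φ ψ p.1 p.2) (Ioi 0 ×ˢ Ioi 0) := by
  refine ContinuousOn.div_const (ContinuousOn.mul ?_ ?_) _
  · exact (hφ.comp (continuous_fst.min continuous_snd)).continuousOn
  · exact hψ.comp (continuous_fst.max continuous_snd).continuousOn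
      fun p hp => mem_Ioi.2 (lt_max_of_lt_left hp.1)

theorem continuousOn_greenKernel_right (ν : ℝ) {φ ψ : ℝ → ℂ} (hφ : Continuous φ)
    (hψ : ContinuousOn ψ (Ioi 0)) {x : ℝ} (hx : 0 < x) :
    ContinuousOn (greenKernel ν φ ψ x) (Ioi 0) :=
  (continuousOn_greenKernel ν hφ hψ).comp (f := fun y : ℝ => (x, y)) (by fun_prop)
    fun _ hy => ⟨hx, hy⟩

/-- A continuous function which is bounded near `0` and a multiple of a square integrable function
near infinity is square integrable. -/
theorem memLp_of_eq_mul_tail {F ψ : ℝ → ℂ} (hF : ContinuousOn F (Ioi 0)) {b M : ℝ}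
    (hb : ∀ x, 0 < x → x ≤ b → ‖F x‖ ≤ M) (hψ : MemLp ψ 2 halfLine) (c : ℂ)
    (h : ∀ x, b < x → F x = c * ψ x) : MemLp F 2 halfLine := by
  have hm : AEStronglyMeasurable F halfLine := hF.aestronglyMeasurable measurableSet_Ioi
  have h1 : MemLp ((Iic b).indicator F) 2 halfLine := by
    rw [memLp_indicator_iff_restrict measurableSet_Iic]
    have hr : halfLine.restrict (Iic b) = volume.restrict (Ioc 0 b) := by
      rw [Measure.restrict_restrict measurableSet_Iic, inter_comm, Ioi_inter_Iic]
    have : IsFiniteMeasure (halfLine.restrict (Iic b)) := by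
      rw [hr]
      exact ⟨by simp⟩
    refine MemLp.of_bound hm.restrict M ?_
    rw [hr]
    filter_upwards [ae_restrict_mem measurableSet_Ioc] with x hx using hb x hx.1 hx.2
  have h2 : MemLp ((Ioi b).indicator fun x => c * ψ x) 2 halfLine :=
    (hψ.const_mul c).indicator measurableSet_Ioi
  refine (h1.add h2).ae_eq (.of_forall fun x => ?_)
  rcases le_or_gt x b with hx | hx
  · simp [hx, not_lt.2 hx]
  · simp [hx, not_le.2 hx, h x hx]

theorem memLp_greenKernel {ν : ℝ} {φ ψ : ℝ → ℂ} (hφ : Continuous φ) (hψ : ContinuousOn ψ (Ioi 0))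
    (hψ2 : MemLp ψ 2 halfLine) {x : ℝ} (hx : 0 < x) : MemLp (greenKernel ν φ ψ x) 2 halfLine := by
  obtain ⟨M, hM⟩ := (isCompact_Icc (a := (0 : ℝ)) (b := x)).exists_bound_of_continuousOn
    (f := fun y => φ y * ψ x / (2 * ν)) (by fun_prop)
  refine memLp_of_eq_mul_tail (continuousOn_greenKernel_right ν hφ hψ hx) (b := x) (M := M)
    (fun y hy hyx => ?_) hψ2 (φ x / (2 * ν)) fun y hy => ?_
  · rw [greenKernel, min_eq_right hyx, max_eq_left hyx]
    exact hM y ⟨hy.le, hyx⟩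
  · rw [greenKernel, min_eq_left hy.le, max_eq_right hy.le]
    ring

/-- The kernel inverts `A^∞ - z` on the test functions. -/
theorem resolvent_eq_integral_of_isTest {ν : ℝ} (hν : 0 < ν) {V : ℝ → ℝ}
    (hV : ContinuousOn V (Ioi 0)) {z : ℂ} {Rinf : H →L[ℂ] H}
    (hR : IsResolvent (AInf ν V) z Rinf) {φ φ₁ ψ ψ₁ : ℝ → ℂ} (hφc : Continuous φ)
    (hφ0 : IsRemainder fun x => φ x - bPlus ν x)
    (hφ : ∀ x > 0, HasDerivAt φ (φ₁ x) x)
    (hφ₁ : ∀ x > 0, HasDerivAt φ₁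
      (((((ν ^ 2 - 1 / 4) / x ^ 2 + V x : ℝ) : ℂ) - z) * φ x) x)
    (hψ : ∀ x > 0, HasDerivAt ψ (ψ₁ x) x)
    (hψ₁ : ∀ x > 0, HasDerivAt ψ₁
      (((((ν ^ 2 - 1 / 4) / x ^ 2 + V x : ℝ) : ℂ) - z) * ψ x) x)
    (hψ2 : MemLp ψ 2 halfLine) (hw : ∀ x > 0, φ₁ x * ψ x - φ x * ψ₁ x = 2 * ν)
    {f : H} {f₀ : ℝ → ℂ} (hf₀ : IsTest f₀) (hf : f =ᵐ[halfLine] f₀) :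
    ∀ᵐ x ∂halfLine, Rinf f x = ∫ y, greenKernel ν φ ψ x y * f y ∂halfLine := by
  have hν' : (ν : ℂ) ≠ 0 := by exact_mod_cast hν.ne'
  have hψc : ContinuousOn ψ (Ioi 0) := fun x hx => (hψ x hx).continuousAt.continuousWithinAt
  obtain ⟨a', b', ha', ha1, hb1, hsupp⟩ := exists_Icc_of_isCompact hf₀.2.1 hf₀.2.2
  obtain ⟨a, ha, haa⟩ := exists_between ha'
  obtain ⟨b, hbb⟩ := exists_gt b'
  have hab : a ≤ b := by linarith
  have hz : ∀ x, x ∉ Ioo a b → f₀ x = 0 := fun x hx =>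
    image_eq_zero_of_notMem_tsupport fun h =>
      hx ⟨haa.trans_le (hsupp h).1, (hsupp h).2.trans_lt hbb⟩
  have hφf : Continuous fun y => φ y * f₀ y := hf₀.continuous_mul hφc.continuousOn
  have hψf : Continuous fun y => ψ y * f₀ y := hf₀.continuous_mul hψc
  set p : ℝ → ℂ := fun x => ∫ y in a..x, φ y * f₀ y with hp
  set r : ℝ → ℂ := fun x => ∫ y in x..b, ψ y * f₀ y with hr
  have hpd : ∀ x, HasDerivAt p (φ x * f₀ x) x := fun x =>
    intervalIntegral.integral_hasDerivAt_right (hφf.intervalIntegrable _ _)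
      (hφf.stronglyMeasurableAtFilter _ _) hφf.continuousAt
  have hrd : ∀ x, HasDerivAt r (-(ψ x * f₀ x)) x := fun x =>
    intervalIntegral.integral_hasDerivAt_left (hψf.intervalIntegrable _ _)
      (hψf.stronglyMeasurableAtFilter _ _) hψf.continuousAt
  set w : ℝ → ℂ := fun x => (ψ x * p x + φ x * r x) / (2 * ν) with hwdef
  -- the image of the test function under the kernel
  have hint : ∀ x > 0, ∫ y, greenKernel ν φ ψ x y * f y ∂halfLine = w x := by
    intro x hx
    have hc : Continuous fun y => greenKernel ν φ ψ x y * f₀ y :=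
      hf₀.continuous_mul (continuousOn_greenKernel_right ν hφc hψc hx)
    have e0 : ∫ y, greenKernel ν φ ψ x y * f y ∂halfLine
        = ∫ y, greenKernel ν φ ψ x y * f₀ y ∂halfLine := by
      refine integral_congr_ae ?_
      filter_upwards [hf] with y hy
      rw [hy]
    have e1 : ∫ y in a..x, greenKernel ν φ ψ x y * f₀ y
        = ∫ y in a..x, ψ x / (2 * ν) * (φ y * f₀ y) := by
      refine intervalIntegral.integral_congr fun y hy => ?_
      rcases le_or_gt y x with hyx | hyx
      · simp only [greenKernel, min_eq_right hyx, max_eq_left hyx]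
        ring
      · have : y ≤ a := by
          rcases le_max_iff.1 hy.2 with h | h
          · exact h
          · exact absurd h (not_le.2 hyx)
        simp only [hz y fun h => absurd h.1 (not_lt.2 this), mul_zero]
    have e2 : ∫ y in x..b, greenKernel ν φ ψ x y * f₀ y
        = ∫ y in x..b, φ x / (2 * ν) * (ψ y * f₀ y) := by
      refine intervalIntegral.integral_congr fun y hy => ?_
      rcases le_or_gt x y with hyx | hyx
      · simp only [greenKernel, min_eq_left hyx, max_eq_right hyx]
        ring
      · have : b ≤ y := by
          rcases min_le_iff.1 hy.1 with h | h
          · exact absurd h (not_le.2 hyx)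
          · exact h
        simp only [hz y fun h => absurd h.2 (not_lt.2 this), mul_zero]
    rw [e0, integral_halfLine_eq_intervalIntegral ha hab
      (fun y hy => by rw [hz y hy, mul_zero]), ← intervalIntegral.integral_add_adjacent_intervals
      (hc.intervalIntegrable a x) (hc.intervalIntegrable x b), e1, e2,
      intervalIntegral.integral_const_mul, intervalIntegral.integral_const_mul]
    simp only [hwdef, hp, hr]
    ring
  have hw1 : ∀ x > 0, HasDerivAt w ((ψ₁ x * p x + φ₁ x * r x) / (2 * ν)) x := fun x hx =>
    ((((hψ x hx).mul (hpd x)).add ((hφ x hx).mul (hrd x))).div_const _).congr_deriv (by ring)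
  have hw2 : ∀ x > 0, HasDerivAt (fun x => (ψ₁ x * p x + φ₁ x * r x) / (2 * ν))
      (((((ν ^ 2 - 1 / 4) / x ^ 2 + V x : ℝ) : ℂ) - z) * w x - f₀ x) x := by
    intro x hx
    refine ((((hψ₁ x hx).mul (hpd x)).add ((hφ₁ x hx).mul (hrd x))).div_const _).congr_deriv ?_
    simp only [hwdef]
    field_simp
    linear_combination (-f₀ x) * hw x hx
  have hwc : ContinuousOn w (Ioi 0) := fun x hx => (hw1 x hx).continuousAt.continuousWithinAt
  have hlow : ∀ x ≤ a, w x = r a / (2 * ν) * φ x := by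
    intro x hx
    have h1 : p x = 0 := by
      refine (intervalIntegral.integral_congr (g := fun _ => 0) fun y hy => ?_).trans (by simp)
      rw [uIcc_of_ge hx] at hy
      simp only [hz y fun h => absurd h.1 (not_lt.2 hy.2), mul_zero]
    have h2 : r x = r a := by
      have h3 : ∫ y in x..a, ψ y * f₀ y = 0 := by
        refine (intervalIntegral.integral_congr (g := fun _ => 0) fun y hy => ?_).trans (by simp)
        rw [uIcc_of_le hx] at hy
        simp only [hz y fun h => absurd h.1 (not_lt.2 hy.2), mul_zero]
      simp only [hr]
      rw [← intervalIntegral.integral_add_adjacent_intervals (hψf.intervalIntegrable x a)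
        (hψf.intervalIntegrable a b), h3, zero_add]
    simp only [hwdef, h1, h2]
    ring
  have hhigh : ∀ x > b, w x = p b / (2 * ν) * ψ x := by
    intro x hx
    have h1 : r x = 0 := by
      refine (intervalIntegral.integral_congr (g := fun _ => 0) fun y hy => ?_).trans (by simp)
      rw [uIcc_of_ge hx.le] at hy
      simp only [hz y fun h => absurd h.2 (not_lt.2 hy.1), mul_zero]
    have h2 : p x = p b := by
      have h3 : ∫ y in b..x, φ y * f₀ y = 0 := by
        refine (intervalIntegral.integral_congr (g := fun _ => 0) fun y hy => ?_).trans (by simp)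
        rw [uIcc_of_le hx.le] at hy
        simp only [hz y fun h => absurd h.2 (not_lt.2 hy.1), mul_zero]
      simp only [hp]
      rw [← intervalIntegral.integral_add_adjacent_intervals (hφf.intervalIntegrable a b)
        (hφf.intervalIntegrable b x), h3, add_zero]
    simp only [hwdef, h1, h2]
    ring
  obtain ⟨M₁, hM₁⟩ := (isCompact_Icc (a := (0 : ℝ)) (b := a)).exists_bound_of_continuousOn
    (f := fun x => r a / (2 * ν) * φ x) (by fun_prop)
  obtain ⟨M₂, hM₂⟩ := (isCompact_Icc (a := a) (b := b)).exists_bound_of_continuousOn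
    (hwc.mono fun x hx => ha.trans_le hx.1)
  have hwm : MemLp w 2 halfLine := by
    refine memLp_of_eq_mul_tail hwc (b := b) (M := max M₁ M₂) (fun x hx hxb => ?_) hψ2 _ hhigh
    rcases le_total x a with hxa | hxa
    · rw [hlow x hxa]
      exact (hM₁ x ⟨hx.le, hxa⟩).trans (le_max_left _ _)
    · exact (hM₂ x ⟨hxa, hxb⟩).trans (le_max_right _ _)
  have hexp : HasExpansion ν (hwm.toLp w) 0 (r a / (2 * ν)) := by
    refine ⟨w, hwm.coeFn_toLp, (hφ0.const_mul (r a / (2 * ν))).congr ?_⟩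
    filter_upwards [mem_nhdsWithin_of_mem_nhds (Iio_mem_nhds ha)] with x hx
    rw [hlow x (le_of_lt hx)]
    ring
  have hgraph : (hwm.toLp w, f + z • hwm.toLp w) ∈ (A ν V).adjoint.graph := by
    refine mem_graph_adjoint_of_hasDerivAt hV hw1 hw2 ?_ hwm.coeFn_toLp ?_
    · exact (((continuousOn_potential ν hV).sub continuousOn_const).mul hwc).sub
        hf₀.1.continuous.continuousOn
    · filter_upwards [hf, hwm.coeFn_toLp, Lp.coeFn_add f (z • hwm.toLp w),
        Lp.coeFn_smul z (hwm.toLp w)] with x h1 h2 h3 h4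
      rw [h3, Pi.add_apply, h4, Pi.smul_apply, h1, h2, smul_eq_mul]
      ring
  have hRf := hR.eq_of_mem_graph (mem_boundarySpace_bPlus_iff.2 ⟨_, hexp⟩) hgraph
  filter_upwards [hwm.coeFn_toLp, ae_restrict_mem measurableSet_Ioi] with x hx hx0
  rw [hRf, hx, hint x hx0]

/-- A bounded operator given by a square integrable kernel on a dense set is given by it
everywhere. -/
theorem forall_eq_integral_of_dense {R : H →L[ℂ] H} {G : ℝ → ℝ → ℂ}
    (hG : ∀ x > 0, MemLp (G x) 2 halfLine) {D : Set H} (hD : Dense D)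
    (h : ∀ f ∈ D, ∀ᵐ x ∂halfLine, R f x = ∫ y, G x y * f y ∂halfLine) (f : H) :
    ∀ᵐ x ∂halfLine, R f x = ∫ y, G x y * f y ∂halfLine := by
  obtain ⟨u, hu, hlim⟩ := mem_closure_iff_seq_limit.1 (hD f)
  have h1 : Tendsto (fun n => R (u n)) atTop (𝓝 (R f)) := (R.continuous.tendsto f).comp hlim
  obtain ⟨ns, hns, hns'⟩ := (tendstoInMeasure_of_tendsto_Lp h1).exists_seq_tendsto_ae
  filter_upwards [hns', ae_all_iff.2 fun n => h _ (hu n), ae_restrict_mem measurableSet_Ioi]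
    with x hx hx' hx0
  have hx0 : 0 < x := hx0
  have hstar : MemLp (fun y => star (G x y)) 2 halfLine := (hG x hx0).star
  have e : ∀ v : H, ∫ y, G x y * v y ∂halfLine = inner ℂ (hstar.toLp _) v := fun v => by
    rw [L2.inner_def]
    refine integral_congr_ae ?_
    filter_upwards [hstar.coeFn_toLp] with y hy
    rw [hy, RCLike.inner_apply]
    simp [mul_comm]
  have hlim2 : Tendsto (fun n => R (u (ns n)) x) atTop (𝓝 (∫ y, G x y * f y ∂halfLine)) := by
    simp only [hx', e]
    exact tendsto_const_nhds.inner (hlim.comp hns.tendsto_atTop)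
  exact tendsto_nhds_unique hx hlim2

/-- The resolvent of `A^∞` has the Green kernel built from the regular solution and any square
integrable solution normalised by `ψ ~ x^{1/2 - ν}`. -/
theorem isKernelRatio_of_mem_graph {ν : ℝ} (hν0 : 0 < ν) (hν1 : ν < 1) {V : ℝ → ℝ}
    (hV : ContinuousOn V (Ici 0)) {z : ℂ} {Rinf : H →L[ℂ] H}
    (hR : IsResolvent (AInf ν V) z Rinf) {u : H} {m : ℂ}
    (hu : (u, z • u) ∈ (A ν V).adjoint.graph) (he : HasExpansion ν u 1 m) :
    IsKernelRatio ν Rinf (-m⁻¹) := by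
  have hV' := hV.mono Ioi_subset_Ici_self
  obtain ⟨ψ, ψ₁, hae, hψ⟩ := exists_classical_of_mem_graph_adjoint hV' hu
  have hψc : ContinuousOn ψ (Ioi 0) := fun x hx => (hψ x hx).1.continuousAt.continuousWithinAt
  have hψ2 : MemLp ψ 2 halfLine := (Lp.memLp u).ae_eq hae
  have hrem := he.isRemainder hae hψc
  -- the potential is extended continuously to the whole line
  obtain ⟨φ, φ₁, hφc, hφ0, hφ⟩ := exists_regular_solution hν0
    (q := fun x => (V (max x 0) : ℂ) - z) ((Complex.continuous_ofReal.comp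
      (hV.comp_continuous (continuous_id.max continuous_const)
      fun x => mem_Ici.2 (le_max_right _ _))).sub
      continuous_const)
  have hφ₁ : ∀ x > 0, HasDerivAt φ₁
      (((((ν ^ 2 - 1 / 4) / x ^ 2 + V x : ℝ) : ℂ) - z) * φ x) x := fun x hx => by
    refine (hφ x hx).2.congr_deriv ?_
    rw [max_eq_left (le_of_lt hx), Complex.ofReal_add]
    ring
  obtain ⟨w, hw⟩ := wronskian_eq_const (fun x hx => (hφ x hx).1) hφ₁ (fun x hx => (hψ x hx).1)
    fun x hx => (hψ x hx).2
  have hφlim : Tendsto (fun x : ℝ => ((x ^ (-(1 / 2 + ν)) : ℝ) : ℂ) * φ x) (𝓝[>] 0) (𝓝 1) :=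
    IsRemainder.tendsto_bPlus hν1 (by simpa using hφ0)
  have hw2 : w = 2 * ν := wronskian_eq_two_mul hν0 (fun x hx => (hφ x hx).1)
    (fun x hx => (hψ x hx).1) hw hφlim (hrem.tendsto_bMinus hν0)
  subst hw2
  have hG := fun x (hx : x > 0) => memLp_greenKernel (ν := ν) hφc hψc hψ2 hx
  refine ⟨greenKernel ν φ ψ, fun y => 1 / (2 * ν) * ψ y, ⟨continuousOn_greenKernel ν hφc hψc, hG,
    forall_eq_integral_of_dense hG (dense_domain_A ν hV') fun f hf => ?_⟩, fun y hy => ?_, ?_⟩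
  · obtain ⟨g, hg⟩ := LinearPMap.mem_domain_iff.1 hf
    rw [A_graph] at hg
    obtain ⟨f₀, hf₀, hf₁, -⟩ := hg
    exact resolvent_eq_integral_of_isTest hν0 hV' hR hφc hφ0 (fun x hx => (hφ x hx).1) hφ₁
      (fun x hx => (hψ x hx).1) (fun x hx => (hψ x hx).2) hψ2 hw hf₀ hf₁
  · have := hφlim.mul_const (1 / (2 * ν) * ψ y)
    rw [one_mul] at this
    refine this.congr' ?_
    filter_upwards [mem_nhdsWithin_of_mem_nhds (Iio_mem_nhds hy)] with x hx
    have hx : x < y := hx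
    rw [greenKernel, min_eq_left hx.le, max_eq_right hx.le, show -(1 / 2 + ν) = -ν - 1 / 2 by ring]
    ring
  · refine (hrem.const_mul (1 / (2 * (ν : ℂ)))).congr (.of_forall fun y => ?_)
    simp only [inv_neg, inv_inv]
    ring

/-! ### The solution space at a common resolvent point -/

theorem HasExpansion.ne_zero {ν : ℝ} (hν0 : 0 < ν) (hν1 : ν < 1) {u : H} {m : ℂ}
    (h : HasExpansion ν u 1 m) : u ≠ 0 := by
  rintro rfl
  exact one_ne_zero (h.eq_zero hν0 hν1).1

/-- An `L²` solution `u = x^{1/2 - ν} + m x^{1/2 + ν} + O(x^{3/2})` of `A† u = z u`: cut off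
`x^{1/2 - ν}` and correct it by the resolvent of `A^∞`. -/
theorem exists_mem_graph_adjoint_smul {ν : ℝ} (hν1 : ν < 1) {V : ℝ → ℝ}
    (hV : ContinuousOn V (Ici 0)) {z : ℂ} {Rinf : H →L[ℂ] H}
    (hR : IsResolvent (AInf ν V) z Rinf) :
    ∃ (u : H) (m : ℂ), (u, z • u) ∈ (A ν V).adjoint.graph ∧ HasExpansion ν u 1 m := by
  obtain ⟨h, g, hg, he⟩ := exists_mem_graph_adjoint_bMinus hν1 hV
  obtain ⟨hm, hgr⟩ := hR.mem_graph (g - z • h)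
  obtain ⟨c, hc⟩ := mem_boundarySpace_bPlus_iff.1 hm
  refine ⟨h - Rinf (g - z • h), 0 - c, ?_, by simpa using he.sub hc⟩
  have := Submodule.sub_mem _ hg hgr
  rw [Prod.mk_sub_mk] at this
  convert this using 2
  rw [smul_sub]
  abel

/-- A solution of `A† u = z u` with the boundary behaviour of a restriction of `A†` vanishes if `z`
is in the resolvent set of this restriction. -/
theorem IsResolvent.eq_zero_of_mem_graph {B : H →ₗ.[ℂ] H} {S : Submodule ℂ H} {z : ℂ}
    {R : H →L[ℂ] H} (h : IsResolvent (B.domRestrict S) z R) {u : H} (hu : u ∈ S)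
    (hg : (u, z • u) ∈ B.graph) : u = 0 := by
  have := h.eq_of_mem_graph (f := 0) hu (by rwa [zero_add])
  rw [← this, map_zero]

theorem IsResolvent.ne_of_hasExpansion {ν : ℝ} (hν0 : 0 < ν) (hν1 : ν < 1) {V : ℝ → ℝ} {z : ℂ}
    {θ : ℝ} {R : H →L[ℂ] H} (h : IsResolvent (ATheta ν V θ) z R) {u : H} {m : ℂ}
    (hu : (u, z • u) ∈ (A ν V).adjoint.graph) (he : HasExpansion ν u 1 m) : m ≠ θ := by
  rintro rfl
  exact he.ne_zero hν0 hν1 (h.eq_zero_of_mem_graph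
    (mem_boundarySpace_theta_iff.2 ⟨1, by rwa [one_mul]⟩) hu)

/-- The difference of two resolvents maps into the span of the solution `u`, and the coefficient
is read off from the boundary expansions. -/
theorem resolvent_sub_eq_smul {ν : ℝ} (hν0 : 0 < ν) (hν1 : ν < 1) {V : ℝ → ℝ} {z : ℂ}
    {S : Submodule ℂ H} {R Rinf : H →L[ℂ] H}
    (hS : IsResolvent ((A ν V).adjoint.domRestrict S) z R) (hR : IsResolvent (AInf ν V) z Rinf)
    {u : H} {m : ℂ} (hu : (u, z • u) ∈ (A ν V).adjoint.graph) (he : HasExpansion ν u 1 m)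
    {f : H} {α β c : ℂ} (h1 : HasExpansion ν (R f) α β) (h2 : HasExpansion ν (Rinf f) 0 c) :
    R f - Rinf f = α • u ∧ β - c = α * m := by
  have hexp := (h1.sub h2).sub (he.smul α)
  rw [sub_zero, mul_one, sub_self] at hexp
  have hgr : (R f - Rinf f - α • u, z • (R f - Rinf f - α • u)) ∈ (A ν V).adjoint.graph := by
    have := Submodule.sub_mem _ (Submodule.sub_mem _ (hS.mem_graph f).2 (hR.mem_graph f).2)
      (Submodule.smul_mem _ α hu)
    rw [Prod.mk_sub_mk, Prod.smul_mk, Prod.mk_sub_mk] at this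
    convert this using 2
    module
  have h0 := hR.eq_zero_of_mem_graph (mem_boundarySpace_bPlus_iff.2 ⟨_, hexp⟩) hgr
  rw [h0] at hexp
  exact ⟨sub_eq_zero.1 h0, sub_eq_zero.1 (hexp.eq_zero hν0 hν1).2⟩

theorem isBoundaryRatio_of_mem_graph {ν : ℝ} (hν0 : 0 < ν) (hν1 : ν < 1) {V : ℝ → ℝ}
    (hV : ContinuousOn V (Ici 0)) {z : ℂ} {R₀ Rinf : H →L[ℂ] H}
    (h₀ : IsResolvent (ATheta ν V 0) z R₀) (hR : IsResolvent (AInf ν V) z Rinf) {u : H} {m : ℂ}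
    (hm : m ≠ 0) (hu : (u, z • u) ∈ (A ν V).adjoint.graph) (he : HasExpansion ν u 1 m) :
    IsBoundaryRatio ν R₀ Rinf (-m⁻¹) := by
  refine ⟨?_, fun f c₀ c hc₀ hc => ?_⟩
  · obtain ⟨h, g, hg, hh⟩ := exists_mem_graph_adjoint_bPlus hν0 hV
    have : Rinf (g - z • h) = h := hR.eq_of_mem_graph (mem_boundarySpace_bPlus_iff.2 ⟨1, hh⟩)
      (by rwa [sub_add_cancel])
    exact ⟨g - z • h, 1, hasBoundaryCoeff_bPlus_iff.2 (this.symm ▸ hh), one_ne_zero⟩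
  · have := (resolvent_sub_eq_smul hν0 hν1 h₀ hR hu he (hasBoundaryCoeff_bMinus_iff.1 hc₀)
      (hasBoundaryCoeff_bPlus_iff.1 hc)).2
    field_simp
    linear_combination -this

/-- Krein's formula, with `K = -1 / m`. -/
theorem krein_formula {ν : ℝ} (hν0 : 0 < ν) (hν1 : ν < 1) {V : ℝ → ℝ} {z : ℂ}
    {R₀ Rinf Rθ : H →L[ℂ] H} {θ : ℝ}
    (h₀ : IsResolvent (ATheta ν V 0) z R₀) (hR : IsResolvent (AInf ν V) z Rinf)
    (hθ : IsResolvent (ATheta ν V θ) z Rθ) {u : H} {m : ℂ}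
    (hm : m ≠ 0) (hu : (u, z • u) ∈ (A ν V).adjoint.graph) (he : HasExpansion ν u 1 m) :
    1 + (θ : ℂ) * -m⁻¹ ≠ 0 ∧ Rθ - Rinf = (1 + (θ : ℂ) * -m⁻¹)⁻¹ • (R₀ - Rinf) := by
  have hmθ := hθ.ne_of_hasExpansion hν0 hν1 hu he
  have hK : 1 + (θ : ℂ) * -m⁻¹ ≠ 0 := by
    intro h
    field_simp at h
    exact hmθ (by linear_combination h)
  refine ⟨hK, ContinuousLinearMap.ext fun f => ?_⟩
  obtain ⟨c, hc⟩ := mem_boundarySpace_bPlus_iff.1 (hR.mem_graph f).1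
  obtain ⟨c₀, hc₀⟩ := mem_boundarySpace_theta_iff.1 (h₀.mem_graph f).1
  obtain ⟨cθ, hcθ⟩ := mem_boundarySpace_theta_iff.1 (hθ.mem_graph f).1
  obtain ⟨e₀, e₀'⟩ := resolvent_sub_eq_smul hν0 hν1 h₀ hR hu he hc₀ hc
  obtain ⟨eθ, eθ'⟩ := resolvent_sub_eq_smul hν0 hν1 hθ hR hu he hcθ hc
  simp only [sub_apply, smul_apply, e₀, eθ, smul_smul]
  congr 1
  rw [eq_inv_mul_iff_mul_eq₀ hK]
  rw [Complex.ofReal_zero] at e₀'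
  field_simp
  linear_combination e₀' - eθ'

/-- The number `K(z)`: the solution `u`, hence `m`, depends on `z` only, not on the resolvents. -/
theorem exists_krein_ratio {ν : ℝ} (hν0 : 0 < ν) (hν1 : ν < 1) {V : ℝ → ℝ}
    (hV : ContinuousOn V (Ici 0)) (z : ℂ) :
    ∃ k : ℂ, ∀ R₀ Rinf : H →L[ℂ] H, IsResolvent (ATheta ν V 0) z R₀ →
      IsResolvent (AInf ν V) z Rinf →
        k ≠ 0 ∧ IsBoundaryRatio ν R₀ Rinf k ∧ IsKernelRatio ν Rinf k ∧
        ∀ (θ : ℝ) (Rθ : H →L[ℂ] H), IsResolvent (ATheta ν V θ) z Rθ →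
          1 + (θ : ℂ) * k ≠ 0 ∧ Rθ - Rinf = (1 + (θ : ℂ) * k)⁻¹ • (R₀ - Rinf) := by
  by_cases hex : ∃ (u : H) (m : ℂ), (u, z • u) ∈ (A ν V).adjoint.graph ∧ HasExpansion ν u 1 m
  · obtain ⟨u, m, hu, he⟩ := hex
    refine ⟨-m⁻¹, fun R₀ Rinf h₀ hR => ?_⟩
    have hm : m ≠ 0 := by simpa using h₀.ne_of_hasExpansion hν0 hν1 hu he
    exact ⟨neg_ne_zero.2 (inv_ne_zero hm),
      isBoundaryRatio_of_mem_graph hν0 hν1 hV h₀ hR hm hu he,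
      isKernelRatio_of_mem_graph hν0 hν1 hV hR hu he,
      fun θ Rθ hθ => krein_formula hν0 hν1 h₀ hR hθ hm hu he⟩
  · exact ⟨0, fun R₀ Rinf _ hR => (hex (exists_mem_graph_adjoint_smul hν1 hV hR)).elim⟩

end SingularKrein

end

theorem theorem3p1 (ν : ℝ) (hν0 : 0 < ν) (hν1 : ν < 1) (V : ℝ → ℝ)
    (hV : AnalyticOn ℝ V (Set.Ici 0)) (hVb : ∃ m : ℝ, ∀ x : ℝ, 0 ≤ x → m ≤ V x) :
    ∃ K : ℂ → ℂ, ∀ (z : ℂ) (R₀ Rinf : SingularKrein.H →L[ℂ] SingularKrein.H),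
      SingularKrein.IsResolvent (SingularKrein.ATheta ν V 0) z R₀ →
      SingularKrein.IsResolvent (SingularKrein.AInf ν V) z Rinf →
        K z ≠ 0 ∧
        SingularKrein.IsBoundaryRatio ν R₀ Rinf (K z) ∧
        SingularKrein.IsKernelRatio ν Rinf (K z) ∧
        ∀ (θ : ℝ) (Rθ : SingularKrein.H →L[ℂ] SingularKrein.H),
          SingularKrein.IsResolvent (SingularKrein.ATheta ν V θ) z Rθ →
            1 + (θ : ℂ) * K z ≠ 0 ∧
            Rθ - Rinf = (1 + (θ : ℂ) * K z)⁻¹ • (R₀ - Rinf) := by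
  choose K hK using fun z => SingularKrein.exists_krein_ratio hν0 hν1 hV.continuousOn z
  exact ⟨K, hK⟩
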